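/- Let $n\ge 0$, let $d$ be a positive odd integer and $\ell=\sqrt{2\pi/d}$. Write vectors of length $2n$ as $\mathbf a=(\mathbf a_X,\mathbf a_Z)$, let $\Omega=\begin{pmatrix}0&\mathbb 1\\-\mathbb 1&0\end{pmatrix}$ and $[\mathbf a,\mathbf b]=\mathbf a^T\Omega\mathbf b$. On $L^2(\mathbb R^n)$ let $\hat{\mathbf r}=(\hat q_1,\dots,\hat q_n,\hat p_1,\dots,\hat p_n)^T$ be the position and momentum operators ($\hat q_j$ is multiplication by $x_j$, $\hat p_j=-i\partial_j$), let $\hat D(\mathbf b)=e^{i\mathbf b^T\Omega\hat{\mathbf r}}$ be the displacement operators and $\hat T_{\mathbf a}=\hat D(-\ell\mathbf a)$. For a density operator $\hat\rho$ on $L^2(\mathbb R^n)$ the multimode Zak-Gross Wigner function is $$W_{\hat\rho}(\boldsymbol\eta)=\frac1{(2\pi)^n}\sum_{\mathbf a\in\mathbb Z^{2n}}e^{i\ell[\mathbf a,\boldsymbol\eta]+i\pi\mathbf a_X^T\mathbf a_Z}\,\mathrm{Tr}(\hat\rho\,\hat T_{\mathbf a}),\qquad\boldsymbol\eta\in\mathbb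 R^{2n},$$ which is $d\ell$-periodic in each coordinate. The series always converges as a tempered distribution in $\boldsymbol\eta$ (integrated term by term against Schwartz functions); pointwise it is understood as an unconditional sum, at the points where it converges. Theorem. Let $S=\begin{pmatrix}A&B\\C&D\end{pmatrix}\in\mathrm{Sp}(2n,\mathbb Z)$ be an integer symplectic matrix and let $\hat U_S$ be a Gaussian unitary described by $S$, that is, a unitary operator on $L^2(\mathbb R^n)$ which maps Schwartz functions to Schwartz functions and satisfies $\hat U_S\hat{\mathbf r}\,\hat U_S^\dagger=S\hat{\mathbf r}$ on them (the convention in which $\hat U_S^\dagger\hat D(\mathbf b)\hat U_S=\hat D(S\mathbf b)$). Let $\bar{\mathbf t}\in\mathbb Z^{2n}$ be the vector of the diagonal entries of $A^TC\oplus B^TD$, and let $$\mathbf t=\frac{\pi}{\ell}\,S\,\Omega^{-1}\,\bar{\mathbf t}.$$ Then for every density operator $\hat\rho$ $$W_{\hat U_S\hat\rho\hat U_S^\dagger}(\boldsymbol\eta)=W_{\hat\rho}(S\boldsymbol\eta-\mathbf t).$$ This holds as an identity of tempered distributions, i.e. $\int W_{\hat U_S\hat\rho\hat U_S^\dagger}(\boldsymbol\eta)\varphi(\boldsymbol\eta)\,d\boldsymbol\eta=\int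 W_{\hat\rho}(\boldsymbol\xi)\,\varphi(S^{-1}(\boldsymbol\xi+\mathbf t))\,d\boldsymbol\xi$ for all Schwartz functions $\varphi$ on $\mathbb R^{2n}$, and also pointwise: for every $\boldsymbol\eta\in\mathbb R^{2n}$ the series for the left-hand side converges unconditionally if and only if the series for the right-hand side does, and then the two sums agree. Moreover $\mathbf t$ is efficiently computable: there is one integer random-access program which, for all $n$ and all $S\in\mathrm{Sp}(2n,\mathbb Z)$, computes from $n$ and $S$ the integer vector $S\Omega^{-1}\bar{\mathbf t}$ (the shift in units of $\pi/\ell$) at a logarithmic (bit) cost that is bounded by a polynomial in the total bit length of the entries of $S$. -/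

import Mathlib

open MeasureTheory Matrix
open scoped SchwartzMap LineDeriv

namespace ZakGross

noncomputable section

/-! ### Phase space of `n` modes

Phase-space vectors are indexed by `Fin n ⊕ Fin n`: the component `Sum.inl j` is the `j`-th entry
of the `X` part and `Sum.inr j` is the `j`-th entry of the `Z` part. -/

/-- The symplectic form `Ω = [[0, 1], [-1, 0]]`. -/
def Omega (n : ℕ) (R : Type*) [CommRing R] : Matrix (Fin n ⊕ Fin n) (Fin n ⊕ Fin n) R :=
  Matrix.fromBlocks 0 1 (-1) 0

/-- The symplectic product `[a, b] = aᵀ Ω b = a_X · b_Z - a_Z · b_X`. -/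
def sympl {n : ℕ} (a b : Fin n ⊕ Fin n → ℝ) : ℝ :=
  a ⬝ᵥ (Omega n ℝ *ᵥ b)

/-- `a_X · a_Z`. -/
def dotXZ {n : ℕ} {R : Type*} [CommRing R] (a : Fin n ⊕ Fin n → R) : R :=
  ∑ j, a (Sum.inl j) * a (Sum.inr j)

/-- An integer vector regarded as a real one. -/
def realVec {n : ℕ} (a : Fin n ⊕ Fin n → ℤ) : Fin n ⊕ Fin n → ℝ := fun i => (a i : ℝ)

/-- An integer matrix regarded as a real one. -/
def realMat {n : ℕ} (S : Matrix (Fin n ⊕ Fin n) (Fin n ⊕ Fin n) ℤ) :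
    Matrix (Fin n ⊕ Fin n) (Fin n ⊕ Fin n) ℝ := S.map (fun z : ℤ => (z : ℝ))

/-! ### Hilbert space, displacement operators, quadratures -/

/-- The Hilbert space `L²(ℝⁿ)` of `n` modes. -/
abbrev Modes (n : ℕ) : Type := Lp ℂ 2 (volume : Measure (Fin n → ℝ))

/-- The phase of the displacement operator `exp (i bᵀ Ω r̂) = exp (i (b_X · p̂ - b_Z · q̂))`. -/
def dispPhase {n : ℕ} (b : Fin n ⊕ Fin n → ℝ) (x : Fin n → ℝ) : ℝ :=
  -(∑ j, b (Sum.inr j) * x j) - dotXZ b / 2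

/-- `exp (i (b_X · p̂ - b_Z · q̂))` applied to the wave function `ψ`. -/
def dispFun {n : ℕ} (b : Fin n ⊕ Fin n → ℝ) (ψ : (Fin n → ℝ) → ℂ) (x : Fin n → ℝ) : ℂ :=
  Complex.exp (Complex.I * (dispPhase b x : ℂ)) * ψ (x + fun j => b (Sum.inl j))

theorem continuous_exp_dispPhase {n : ℕ} (b : Fin n ⊕ Fin n → ℝ) :
    Continuous fun x : Fin n → ℝ => Complex.exp (Complex.I * (dispPhase b x : ℂ)) := by
  unfold dispPhase; fun_prop

theorem memLp_shift {n : ℕ} (b : Fin n → ℝ) (ψ : Modes n) :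
    MemLp (fun x : Fin n → ℝ => ψ (x + b)) 2 (volume : Measure (Fin n → ℝ)) :=
  (Lp.memLp ψ).comp_measurePreserving (measurePreserving_add_right volume b)

theorem memLp_dispFun {n : ℕ} (b : Fin n ⊕ Fin n → ℝ) (ψ : Modes n) :
    MemLp (dispFun b ψ) 2 (volume : Measure (Fin n → ℝ)) := by
  have h := memLp_shift (fun j => b (Sum.inl j)) ψ
  refine h.of_le ((continuous_exp_dispPhase b).aestronglyMeasurable.mul
    h.aestronglyMeasurable) (Filter.Eventually.of_forall fun x => ?_)
  simp [dispFun]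

theorem dispFun_congr {n : ℕ} (b : Fin n ⊕ Fin n → ℝ) {f g : (Fin n → ℝ) → ℂ}
    (h : f =ᵐ[volume] g) : dispFun b f =ᵐ[volume] dispFun b g := by
  have h' := (measurePreserving_add_right (volume : Measure (Fin n → ℝ))
    (fun j => b (Sum.inl j))).quasiMeasurePreserving.ae_eq_comp h
  filter_upwards [h'] with x hx
  simp only [Function.comp_apply] at hx
  simp [dispFun, hx]

/-- The displacement operator `D(b) = exp (i bᵀ Ω r̂)`, `r̂ = (q̂₁, …, q̂ₙ, p̂₁, …, p̂ₙ)`, where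
`q̂ⱼ` is multiplication by `xⱼ` and `p̂ⱼ = -i ∂ⱼ`:
`(D(b) ψ)(x) = exp (-i b_Z · x - i b_X · b_Z / 2) ψ (x + b_X)`. -/
def displacement {n : ℕ} (b : Fin n ⊕ Fin n → ℝ) : Modes n →L[ℂ] Modes n :=
  LinearMap.mkContinuous
    { toFun := fun ψ => (memLp_dispFun b ψ).toLp (dispFun b ψ)
      map_add' := by
        intro ψ χ
        rw [← MemLp.toLp_add]
        refine MemLp.toLp_congr _ _ ((dispFun_congr b (Lp.coeFn_add ψ χ)).trans ?_)
        exact Filter.Eventually.of_forall fun x => by simp [dispFun, mul_add]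
      map_smul' := by
        intro c ψ
        rw [RingHom.id_apply, ← MemLp.toLp_const_smul]
        refine MemLp.toLp_congr _ _ ((dispFun_congr b (Lp.coeFn_smul c ψ)).trans ?_)
        exact Filter.Eventually.of_forall fun x => by simp [dispFun, mul_left_comm] }
    1 (by
      intro ψ
      have h : eLpNorm (dispFun b ψ) 2 (volume : Measure (Fin n → ℝ)) = eLpNorm ψ 2 volume := by
        rw [← eLpNorm_comp_measurePreserving (Lp.aestronglyMeasurable ψ)
          (measurePreserving_add_right volume (fun j => b (Sum.inl j)))]
        refine eLpNorm_congr_norm_ae (Filter.Eventually.of_forall fun x => ?_)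
        simp [dispFun]
      rw [one_mul, Lp.norm_def ψ, ← h]
      exact (Lp.norm_toLp _ (memLp_dispFun b ψ)).le)

theorem coeFn_displacement {n : ℕ} (b : Fin n ⊕ Fin n → ℝ) (ψ : Modes n) :
    displacement b ψ =ᵐ[volume] dispFun b ψ :=
  (memLp_dispFun b ψ).coeFn_toLp

/-- The quadrature `r̂ᵢ` on Schwartz functions: `q̂ⱼ f = xⱼ f` and `p̂ⱼ f = -i ∂ⱼ f`. -/
def quadrature {n : ℕ} : Fin n ⊕ Fin n → 𝓢(Fin n → ℝ, ℂ) → 𝓢(Fin n → ℝ, ℂ)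
  | Sum.inl j, f => SchwartzMap.smulLeftCLM ℂ (fun x : Fin n → ℝ => x j) f
  | Sum.inr j, f => (-Complex.I) • ∂_{(Pi.single j 1 : Fin n → ℝ)} f

theorem quadrature_inl_apply {n : ℕ} (j : Fin n) (f : 𝓢(Fin n → ℝ, ℂ)) (x : Fin n → ℝ) :
    quadrature (Sum.inl j) f x = (x j : ℂ) * f x := by
  have h : Function.HasTemperateGrowth (fun x : Fin n → ℝ => x j) :=
    (ContinuousLinearMap.proj (R := ℝ) (φ := fun _ : Fin n => ℝ) j).hasTemperateGrowth
  simp [quadrature, SchwartzMap.smulLeftCLM_apply_apply h]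

theorem quadrature_inr_apply {n : ℕ} (j : Fin n) (f : 𝓢(Fin n → ℝ, ℂ)) (x : Fin n → ℝ) :
    quadrature (Sum.inr j) f x = -Complex.I * lineDeriv ℝ f x (Pi.single j 1) := by
  simp [quadrature, SchwartzMap.lineDerivOp_apply]

/-- `U` is a Gaussian unitary (without displacement part) described by the symplectic matrix `S`:
a unitary operator on `L²(ℝⁿ)` that acts linearly on the quadratures, `U r̂ U† = S r̂`, as operators
on Schwartz functions, which `U` leaves invariant. For the displacement operators this is the
convention `U† D(b) U = D(S b)`. -/
structure IsGaussianUnitary {n : ℕ} (S : Matrix (Fin n ⊕ Fin n) (Fin n ⊕ Fin n) ℝ)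
    (U : Modes n →L[ℂ] Modes n) : Prop where
  unitary : U ∈ unitary (Modes n →L[ℂ] Modes n)
  quadratures : ∀ f : 𝓢(Fin n → ℝ, ℂ), ∃ g : 𝓢(Fin n → ℝ, ℂ),
    U (f.toLp 2 volume) = g.toLp 2 volume ∧
    ∀ i, U ((quadrature i f).toLp 2 volume) =
      (∑ k, (S i k : ℂ) • quadrature k g).toLp 2 volume

/-! ### Trace and states -/

section Trace

variable {H : Type*} [NormedAddCommGroup H] [InnerProductSpace ℂ H] [CompleteSpace H]

/-- The index set of a Hilbert basis of `H`. -/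
def basisIndex (H : Type*) [NormedAddCommGroup H] [InnerProductSpace ℂ H] [CompleteSpace H] :
    Set H := (exists_hilbertBasis ℂ H).choose

/-- A Hilbert basis of `H`. -/
def basis (H : Type*) [NormedAddCommGroup H] [InnerProductSpace ℂ H] [CompleteSpace H] :
    HilbertBasis (basisIndex H) ℂ H := (exists_hilbertBasis ℂ H).choose_spec.choose

/-- The trace of an operator (for a trace-class operator it does not depend on the basis). -/
def opTrace (T : H →L[ℂ] H) : ℂ := ∑' i, inner ℂ (basis H i) (T (basis H i))

/-- Density operators: positive operators of trace one. -/
structure IsDensityOperator (ρ : H →L[ℂ] H) : Prop where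
  isPositive : ρ.IsPositive
  trace_one : HasSum (fun i => inner ℂ (basis H i) (ρ (basis H i))) 1

end Trace

/-! ### The Zak-Gross Wigner function -/

/-- `ℓ = √(2π/d)`. -/
def ell (d : ℕ) : ℝ := Real.sqrt (2 * Real.pi / d)

/-- `T_a = D(-ℓ a)`. -/
def logicalShift (d : ℕ) {n : ℕ} (a : Fin n ⊕ Fin n → ℝ) : Modes n →L[ℂ] Modes n :=
  displacement (-(ell d • a))

/-- The term of index `a ∈ ℤ²ⁿ` of `Tr (ρ A_η)`, that is,
`(2π)⁻ⁿ exp (iℓ[a, η] + iπ a_X · a_Z) Tr (ρ T_a)`. -/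
def wignerTerm (d : ℕ) {n : ℕ} (ρ : Modes n →L[ℂ] Modes n) (η : Fin n ⊕ Fin n → ℝ)
    (a : Fin n ⊕ Fin n → ℤ) : ℂ :=
  (1 / (2 * Real.pi) ^ n : ℂ) *
    Complex.exp (Complex.I * ((ell d * sympl (realVec a) η : ℝ) : ℂ)
      + Complex.I * Real.pi * ((dotXZ a : ℤ) : ℂ)) *
    opTrace (ρ * logicalShift d (realVec a))

/-- The Zak-Gross Wigner function `W_ρ(η) = Tr (ρ A_η)`; it is `dℓ`-periodic in each coordinate
of `η`. The value is meaningful at the points where the series converges. -/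
def zakGrossWigner (d : ℕ) {n : ℕ} (ρ : Modes n →L[ℂ] Modes n) (η : Fin n ⊕ Fin n → ℝ) : ℂ :=
  ∑' a, wignerTerm d ρ η a

/-- The term of index `a` of `∫ W_ρ(η) φ(η) dη`, the Zak-Gross Wigner function smeared with `φ`. -/
def smearedTerm (d : ℕ) {n : ℕ} (ρ : Modes n →L[ℂ] Modes n) (φ : (Fin n ⊕ Fin n → ℝ) → ℂ)
    (a : Fin n ⊕ Fin n → ℤ) : ℂ :=
  ∫ η, wignerTerm d ρ η a * φ η

/-- The Zak-Gross Wigner function as a (periodic, tempered) distribution: `φ ↦ ∫ W_ρ(η) φ(η) dη`,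
the series `Tr (ρ A_η)` being integrated term by term. -/
def smearedWigner (d : ℕ) {n : ℕ} (ρ : Modes n →L[ℂ] Modes n)
    (φ : (Fin n ⊕ Fin n → ℝ) → ℂ) : ℂ :=
  ∑' a, smearedTerm d ρ φ a

/-! ### The shift -/

/-- The diagonal of `AᵀC ⊕ BᵀD`, where `S = [[A, B], [C, D]]`. -/
def tbar {n : ℕ} (S : Matrix (Fin n ⊕ Fin n) (Fin n ⊕ Fin n) ℤ) : Fin n ⊕ Fin n → ℤ :=
  Matrix.diag (Matrix.fromBlocks (S.toBlocks₁₁ᵀ * S.toBlocks₂₁) 0 0 (S.toBlocks₁₂ᵀ * S.toBlocks₂₂))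

/-- The integer vector `S Ω⁻¹ t̄`. -/
def shiftCoeff {n : ℕ} (S : Matrix (Fin n ⊕ Fin n) (Fin n ⊕ Fin n) ℤ) : Fin n ⊕ Fin n → ℤ :=
  (S * (Omega n ℤ)⁻¹) *ᵥ tbar S

/-- The shift `t = (π/ℓ) S Ω⁻¹ t̄`. -/
def shift (d : ℕ) {n : ℕ} (S : Matrix (Fin n ⊕ Fin n) (Fin n ⊕ Fin n) ℤ) : Fin n ⊕ Fin n → ℝ :=
  (Real.pi / ell d) • realVec (shiftCoeff S)

end

/-! ### A machine model with bit cost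

Integer random-access programs with countably many registers and arrays (a program uses finitely
many of them), all holding integers of unbounded size, under the logarithmic cost criterion: an
instruction costs at least the number of bits of the integers and addresses that it handles, and a
multiplication costs the product of the bit lengths of its factors. -/

/-- The contents of the registers and of the arrays. -/
structure State where
  reg : ℕ → ℤ
  arr : ℕ → ℕ → ℤ

/-- Programs. -/
inductive Prog : Type
  /-- `r := z` -/
  | const (r : ℕ) (z : ℤ)
  /-- `r := s + t` -/
  | add (r s t : ℕ)
  /-- `r := s - t` -/
  | sub (r s t : ℕ)
  /-- `r := s * t` -/
  | mul (r s t : ℕ)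
  /-- `r := k[s]` -/
  | load (r k s : ℕ)
  /-- `k[s] := r` -/
  | store (k s r : ℕ)
  /-- `P; Q` -/
  | seq (P Q : Prog)
  /-- run `P` as many times as the value of `r` on entry says -/
  | loop (r : ℕ) (P : Prog)

/-- The number of bits of an integer, with a sign bit. -/
def bits (z : ℤ) : ℕ := z.natAbs.size + 1

/-- Write `z` to the register `r`. -/
def State.setReg (σ : State) (r : ℕ) (z : ℤ) : State :=
  { σ with reg := Function.update σ.reg r z }

/-- Write `z` to the entry `i` of the array `k`. -/
def State.setArr (σ : State) (k i : ℕ) (z : ℤ) : State :=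
  { σ with arr := Function.update σ.arr k (Function.update (σ.arr k) i z) }

/-- The state after the run of a program, and the cost of the run. -/
def Prog.exec : Prog → State → State × ℕ
  | .const r z, σ => (σ.setReg r z, bits z)
  | .add r s t, σ => (σ.setReg r (σ.reg s + σ.reg t), bits (σ.reg s) + bits (σ.reg t))
  | .sub r s t, σ => (σ.setReg r (σ.reg s - σ.reg t), bits (σ.reg s) + bits (σ.reg t))
  | .mul r s t, σ => (σ.setReg r (σ.reg s * σ.reg t), bits (σ.reg s) * bits (σ.reg t))
  | .load r k s, σ =>
      (σ.setReg r (σ.arr k (σ.reg s).toNat),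
        bits (σ.reg s) + bits (σ.arr k (σ.reg s).toNat))
  | .store k s r, σ =>
      (σ.setArr k (σ.reg s).toNat (σ.reg r), bits (σ.reg s) + bits (σ.reg r))
  | .seq P Q, σ =>
      ((Q.exec (P.exec σ).1).1, (P.exec σ).2 + (Q.exec (P.exec σ).1).2)
  | .loop r P, σ =>
      (fun τ : State × ℕ => ((P.exec τ.1).1, τ.2 + (P.exec τ.1).2 + bits (σ.reg r)))^[
        (σ.reg r).toNat] (σ, bits (σ.reg r))

/-- The position `0, …, 2n - 1` of an index: first the `X` part, then the `Z` part. -/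
def position {n : ℕ} (i : Fin n ⊕ Fin n) : ℕ := (finSumFinEquiv i : Fin (n + n))

/-- The `2n × 2n` matrix `S` written row by row into an array, which is zero elsewhere. -/
def matrixArray {n : ℕ} (S : Matrix (Fin n ⊕ Fin n) (Fin n ⊕ Fin n) ℤ) (m : ℕ) : ℤ :=
  if h : m < (n + n) * (n + n) then
    S (finSumFinEquiv.symm (finProdFinEquiv.symm ⟨m, h⟩).1)
      (finSumFinEquiv.symm (finProdFinEquiv.symm ⟨m, h⟩).2)
  else 0

/-- The input: `n` in register `0`, the matrix `S` in array `0`, and zero everywhere else. -/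
def inputState {n : ℕ} (S : Matrix (Fin n ⊕ Fin n) (Fin n ⊕ Fin n) ℤ) : State where
  reg := fun r => if r = 0 then (n : ℤ) else 0
  arr := fun k => if k = 0 then matrixArray S else fun _ => 0

/-- The bit length of the matrix `S`. -/
def bitLength {n : ℕ} (S : Matrix (Fin n ⊕ Fin n) (Fin n ⊕ Fin n) ℤ) : ℕ :=
  ∑ i, ∑ j, bits (S i j)

/-- The integer vector-valued function `f` of the `2n × 2n` integer matrices with the property `p`
is computable in polynomial time: one program computes it for all `n` and leaves the result in
array `1`, at a cost polynomial in the bit length of the matrix. -/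
def PolyTimeOn (p : ∀ n : ℕ, Matrix (Fin n ⊕ Fin n) (Fin n ⊕ Fin n) ℤ → Prop)
    (f : ∀ n : ℕ, Matrix (Fin n ⊕ Fin n) (Fin n ⊕ Fin n) ℤ → Fin n ⊕ Fin n → ℤ) : Prop :=
  ∃ (P : Prog) (c k : ℕ), ∀ (n : ℕ) (S : Matrix (Fin n ⊕ Fin n) (Fin n ⊕ Fin n) ℤ), p n S →
    (∀ i, (P.exec (inputState S)).1.arr 1 (position i) = f n S i) ∧
    (P.exec (inputState S)).2 ≤ c * (bitLength S + 1) ^ k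

end ZakGross

/-!
The two Wigner series are matched term by term. Let `S` be symplectic and `U` described by `S`.

* For Schwartz functions `f`, `g`, the function `s ↦ ⟪D(s b) g, U D(s S b) f⟫` has derivative zero,
  because `U` intertwines the generators of the two displacement groups. Hence
  `D(b) U = U D(S b)`, and cyclicity of the trace turns the coefficient of `U ρ U†` at `a` into the
  coefficient of `ρ` at `S a`.
* With `N = [[0, 1], [0, 0]]`, so that `a_X · a_Z = a · N a` and `Ω = N - Nᵀ`, the equation
  `Sᵀ Ω S = Ω` says that `Sᵀ N S - N` is symmetric. Its diagonal is `t̄`, and a symmetric integral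
  quadratic form is linear modulo `2`, so `(S a)_X · (S a)_Z - a_X · a_Z` is congruent to `a · t̄`.
  The sign that this produces is exactly the character `exp (-iℓ [S a, t])`.
* The trace coefficients are bounded, and integrated against a Schwartz function the characters
  decay rapidly in `a`, so that the smeared series converge.
* The entries of `S Ω⁻¹ t̄` are sums of polynomially many products of entries of `S`.
-/

namespace ZakGross

/-! ### Hilbert-Schmidt and trace-class operators -/

section TraceClass

variable {H : Type*} [NormedAddCommGroup H] [InnerProductSpace ℂ H] {ι : Type*}

theorem hasSum_norm_sq_inner_hilbertBasis (b : HilbertBasis ι ℂ H) (x : H) :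
    HasSum (fun i => ‖inner ℂ x (b i)‖ ^ 2) (‖x‖ ^ 2) := by
  have h := Complex.hasSum_re (b.hasSum_inner_mul_inner x x)
  rw [inner_self_eq_norm_sq_to_K] at h
  convert h using 2 with i
  · rw [← inner_conj_symm (b i) x, Complex.mul_conj, Complex.ofReal_re, Complex.normSq_eq_norm_sq]
  · norm_cast

variable [CompleteSpace H] {A B T ρ U : H →L[ℂ] H}

/-- Hilbert-Schmidt operators: `∑ᵢ ‖A eᵢ‖²` is finite, where `e` is the Hilbert basis `basis H` by
which `opTrace` is computed. -/
def IsHilbertSchmidt (A : H →L[ℂ] H) : Prop :=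
  Summable fun i => ‖A (basis H i)‖ ^ 2

theorem IsHilbertSchmidt.summable_norm_sq_inner (hA : IsHilbertSchmidt A) :
    Summable fun p : basisIndex H × basisIndex H =>
      ‖inner ℂ (A (basis H p.1)) (basis H p.2)‖ ^ 2 := by
  have hrow (i : basisIndex H) := hasSum_norm_sq_inner_hilbertBasis (basis H) (A (basis H i))
  refine (summable_prod_of_nonneg (f := fun p : basisIndex H × basisIndex H =>
    ‖inner ℂ (A (basis H p.1)) (basis H p.2)‖ ^ 2) fun p => sq_nonneg _).2
      ⟨fun i => (hrow i).summable, ?_⟩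
  exact Summable.congr hA fun i => (hrow i).tsum_eq.symm

protected theorem IsHilbertSchmidt.star (hA : IsHilbertSchmidt A) : IsHilbertSchmidt (star A) := by
  refine hA.summable_norm_sq_inner.prod_symm.prod.congr fun j => ?_
  rw [← (hasSum_norm_sq_inner_hilbertBasis (basis H) _).tsum_eq]
  refine tsum_congr fun i => ?_
  rw [Prod.fst_swap, Prod.snd_swap, ContinuousLinearMap.star_eq_adjoint,
    ContinuousLinearMap.adjoint_inner_left, ← inner_conj_symm, RCLike.norm_conj]

theorem IsHilbertSchmidt.mul_left (hA : IsHilbertSchmidt A) (T : H →L[ℂ] H) :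
    IsHilbertSchmidt (T * A) := by
  refine Summable.of_nonneg_of_le (fun _ => sq_nonneg _) (fun i => ?_)
    (Summable.mul_left (‖T‖ ^ 2) hA)
  rw [mul_apply_eq_comp, ← mul_pow]
  gcongr
  exact T.le_opNorm _

theorem IsHilbertSchmidt.mul_right (hA : IsHilbertSchmidt A) (T : H →L[ℂ] H) :
    IsHilbertSchmidt (A * T) := by
  simpa only [star_mul, star_star] using (hA.star.mul_left (star T)).star

theorem inner_mul_apply (A B : H →L[ℂ] H) (x y : H) :
    inner ℂ x ((A * B) y) = inner ℂ (star A x) (B y) := by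
  rw [mul_apply_eq_comp, ContinuousLinearMap.star_eq_adjoint,
    ContinuousLinearMap.adjoint_inner_left]

theorem IsHilbertSchmidt.opTrace_mul_comm (hA : IsHilbertSchmidt A) (hB : IsHilbertSchmidt B) :
    opTrace (A * B) = opTrace (B * A) := by
  let m (i j : basisIndex H) : ℂ :=
    inner ℂ (star A (basis H i)) (basis H j) * inner ℂ (basis H j) (B (basis H i))
  have hm : Summable (Function.uncurry m) := by
    refine Summable.of_norm_bounded (hA.star.summable_norm_sq_inner.add
      hB.summable_norm_sq_inner) fun p => ?_
    rw [Function.uncurry_def, norm_mul, ← inner_conj_symm (basis H p.2), RCLike.norm_conj]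
    generalize ‖inner ℂ (star A (basis H p.1)) (basis H p.2)‖ = x
    generalize ‖inner ℂ (B (basis H p.1)) (basis H p.2)‖ = y
    nlinarith [sq_nonneg (x - y), sq_nonneg (x + y)]
  calc opTrace (A * B)
      = ∑' i, ∑' j, m i j := tsum_congr fun i => by
        rw [inner_mul_apply, ((basis H).hasSum_inner_mul_inner _ _).tsum_eq]
    _ = ∑' j, ∑' i, m i j := hm.tsum_comm.symm
    _ = opTrace (B * A) := tsum_congr fun j => by
        rw [inner_mul_apply, ← ((basis H).hasSum_inner_mul_inner _ _).tsum_eq]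
        refine tsum_congr fun i => ?_
        simp only [m, ContinuousLinearMap.star_eq_adjoint, ContinuousLinearMap.adjoint_inner_left]
        rw [mul_comm]

/-- Trace-class operators, as products of two Hilbert-Schmidt operators; for these the trace is
cyclic. -/
def IsTraceClass (T : H →L[ℂ] H) : Prop :=
  ∃ A B : H →L[ℂ] H, IsHilbertSchmidt A ∧ IsHilbertSchmidt B ∧ T = A * B

theorem IsTraceClass.mul_right (hT : IsTraceClass ρ) (T : H →L[ℂ] H) : IsTraceClass (ρ * T) := by
  obtain ⟨A, B, hA, hB, rfl⟩ := hT
  exact ⟨A, B * T, hA, hB.mul_right T, mul_assoc A B T⟩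

theorem IsTraceClass.opTrace_conj (hT : IsTraceClass T) (hU : U ∈ unitary (H →L[ℂ] H)) :
    opTrace (U * T * star U) = opTrace T := by
  obtain ⟨A, B, hA, hB, rfl⟩ := hT
  calc opTrace (U * (A * B) * star U)
      = opTrace ((U * A) * (B * star U)) := by simp only [mul_assoc]
    _ = opTrace ((B * star U) * (U * A)) := (hA.mul_left U).opTrace_mul_comm (hB.mul_right _)
    _ = opTrace (B * ((star U * U) * A)) := by simp only [mul_assoc]
    _ = opTrace (A * B) := by
        rw [Unitary.star_mul_self_of_mem hU, one_mul, hB.opTrace_mul_comm hA]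

theorem IsTraceClass.exists_norm_opTrace_mul_le (hρ : IsTraceClass ρ) :
    ∃ C, ∀ T : H →L[ℂ] H, ‖opTrace (ρ * T)‖ ≤ C * ‖T‖ := by
  obtain ⟨A, B, hA, hB, rfl⟩ := hρ
  have hsum : Summable fun i => ‖star B (basis H i)‖ ^ 2 + ‖A (basis H i)‖ ^ 2 := hB.star.add hA
  refine ⟨∑' i, (‖star B (basis H i)‖ ^ 2 + ‖A (basis H i)‖ ^ 2), fun T => ?_⟩
  rw [mul_assoc, hA.opTrace_mul_comm (hB.mul_right T), mul_assoc]
  refine tsum_of_norm_bounded (hsum.hasSum.mul_right ‖T‖) fun i => ?_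
  calc ‖inner ℂ (basis H i) ((B * (T * A)) (basis H i))‖
      ≤ ‖star B (basis H i)‖ * ‖T (A (basis H i))‖ := by
        rw [inner_mul_apply]
        exact norm_inner_le_norm _ _
    _ ≤ ‖star B (basis H i)‖ * (‖T‖ * ‖A (basis H i)‖) := by gcongr; exact T.le_opNorm _
    _ = (‖star B (basis H i)‖ * ‖A (basis H i)‖) * ‖T‖ := by ring
    _ ≤ (‖star B (basis H i)‖ ^ 2 + ‖A (basis H i)‖ ^ 2) * ‖T‖ := by
        gcongr
        nlinarith [sq_nonneg (‖star B (basis H i)‖ - ‖A (basis H i)‖),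
          sq_nonneg (‖star B (basis H i)‖ + ‖A (basis H i)‖)]

theorem IsDensityOperator.isTraceClass (hρ : IsDensityOperator ρ) : IsTraceClass ρ := by
  have hnonneg : 0 ≤ ρ := (ContinuousLinearMap.nonneg_iff_isPositive ρ).2 hρ.isPositive
  have hstar : star (CFC.sqrt ρ) = CFC.sqrt ρ := (CFC.sqrt_nonneg ρ).isSelfAdjoint
  have hmul : CFC.sqrt ρ * CFC.sqrt ρ = ρ := CFC.sqrt_mul_sqrt_self ρ hnonneg
  have hsqrt : IsHilbertSchmidt (CFC.sqrt ρ) := by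
    refine (Complex.hasSum_re hρ.trace_one).summable.congr fun i => ?_
    nth_rw 1 [← hmul]
    rw [inner_mul_apply, hstar, inner_self_eq_norm_sq_to_K]
    norm_cast
  exact ⟨_, _, hsqrt, hsqrt, hmul.symm⟩

end TraceClass

/-! ### Integer symplectic matrices -/

theorem sum_sum_eq_sum_diag_of_charTwo {ι R : Type*} [Semiring R] [CharP R 2] (s : Finset ι)
    {f : ι → ι → R} (hf : ∀ i j, f i j = f j i) : ∑ i ∈ s, ∑ j ∈ s, f i j = ∑ i ∈ s, f i i := by
  classical
  induction s using Finset.induction_on with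
  | empty => simp
  | insert a s ha ih =>
    have hcross : ∑ i ∈ s, f i a = ∑ j ∈ s, f a j := Finset.sum_congr rfl fun i _ => hf i a
    simp only [Finset.sum_insert ha, Finset.sum_add_distrib, ih, hcross]
    rw [add_assoc, ← add_assoc (∑ j ∈ s, f a j), CharTwo.add_self_eq_zero, zero_add]

theorem even_dotProduct_mulVec_sub_dotProduct_diag {ι : Type*} [Fintype ι] {M : Matrix ι ι ℤ}
    (hM : M.IsSymm) (x : ι → ℤ) : Even (x ⬝ᵥ (M *ᵥ x) - x ⬝ᵥ M.diag) := by
  have hsq (t : ZMod 2) : t * t = t := by revert t; decide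
  have hsymm (i j : ι) : ((x i * (M i j * x j) : ℤ) : ZMod 2) = ((x j * (M j i * x i) : ℤ)) := by
    rw [hM.apply j i]
    congr 1
    ring
  rw [← ZMod.intCast_eq_zero_iff_even, Int.cast_sub, sub_eq_zero]
  simp only [dotProduct, mulVec, Finset.mul_sum, Matrix.diag_apply, Int.cast_sum]
  rw [sum_sum_eq_sum_diag_of_charTwo _ hsymm]
  refine Finset.sum_congr rfl fun i _ => ?_
  push_cast
  rw [mul_left_comm, hsq, mul_comm]

section Symplectic

variable {n : ℕ} {R : Type*} [CommRing R]

theorem Omega_eq_neg_J : Omega n R = -Matrix.J (Fin n) R := by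
  simp [Omega, Matrix.J, Matrix.fromBlocks_neg]

theorem Omega_mul_Omega : Omega n R * Omega n R = -1 := by
  rw [Omega_eq_neg_J, neg_mul_neg, Matrix.J_squared]

theorem Omega_inv : (Omega n R)⁻¹ = -Omega n R :=
  Matrix.inv_eq_right_inv (by rw [mul_neg, Omega_mul_Omega, neg_neg])

theorem vecMul_Omega (b : Fin n ⊕ Fin n → R) :
    b ᵥ* Omega n R = Sum.elim (-(b ∘ Sum.inr)) (b ∘ Sum.inl) := by
  rw [Omega, ← Sum.elim_comp_inl_inr b, Matrix.vecMul_fromBlocks]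
  simp [Matrix.vecMul_neg]

theorem transpose_mul_Omega_mul {S : Matrix (Fin n ⊕ Fin n) (Fin n ⊕ Fin n) R}
    (hS : S ∈ Matrix.symplecticGroup (Fin n) R) : Sᵀ * Omega n R * S = Omega n R := by
  rw [Omega_eq_neg_J, mul_neg, neg_mul, SymplecticGroup.mem_iff'.1 hS]

/-- The matrix `N = [[0, 1], [0, 0]]` of the quadratic form `a ↦ a_X · a_Z`; it is half of the
symplectic form in the sense that `Ω = N - Nᵀ`. -/
def halfOmega (n : ℕ) (R : Type*) [CommRing R] : Matrix (Fin n ⊕ Fin n) (Fin n ⊕ Fin n) R :=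
  Matrix.fromBlocks 0 1 0 0

theorem Omega_eq_halfOmega_sub_transpose : Omega n R = halfOmega n R - (halfOmega n R)ᵀ := by
  simp [Omega, halfOmega, sub_eq_add_neg, Matrix.fromBlocks_transpose, Matrix.fromBlocks_neg,
    Matrix.fromBlocks_add]

theorem dotXZ_eq_dotProduct_halfOmega_mulVec (a : Fin n ⊕ Fin n → R) :
    dotXZ a = a ⬝ᵥ (halfOmega n R *ᵥ a) := by
  rw [halfOmega, Matrix.fromBlocks_mulVec]
  simp [dotXZ, dotProduct, Fintype.sum_sum_type]

theorem dotXZ_mulVec_sub (S : Matrix (Fin n ⊕ Fin n) (Fin n ⊕ Fin n) R) (a : Fin n ⊕ Fin n → R) :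
    dotXZ (S *ᵥ a) - dotXZ a = a ⬝ᵥ ((Sᵀ * halfOmega n R * S - halfOmega n R) *ᵥ a) := by
  rw [dotXZ_eq_dotProduct_halfOmega_mulVec, dotXZ_eq_dotProduct_halfOmega_mulVec,
    Matrix.mulVec_mulVec, Matrix.dotProduct_mulVec, Matrix.vecMul_mulVec,
    ← Matrix.dotProduct_mulVec, ← Matrix.mul_assoc, Matrix.sub_mulVec, dotProduct_sub]

theorem isSymm_transpose_mul_halfOmega_mul_sub {S : Matrix (Fin n ⊕ Fin n) (Fin n ⊕ Fin n) R}
    (hS : S ∈ Matrix.symplecticGroup (Fin n) R) :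
    (Sᵀ * halfOmega n R * S - halfOmega n R).IsSymm := by
  have h := transpose_mul_Omega_mul hS
  rw [Omega_eq_halfOmega_sub_transpose, Matrix.mul_sub, Matrix.sub_mul] at h
  rw [Matrix.IsSymm, Matrix.transpose_sub, Matrix.transpose_mul, Matrix.transpose_mul,
    Matrix.transpose_transpose, ← Matrix.mul_assoc]
  exact (sub_eq_sub_iff_sub_eq_sub.1 h).symm

theorem diag_transpose_mul_halfOmega_mul_sub (S : Matrix (Fin n ⊕ Fin n) (Fin n ⊕ Fin n) ℤ) :
    (Sᵀ * halfOmega n ℤ * S - halfOmega n ℤ).diag = tbar S := by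
  rw [tbar]
  conv_lhs => rw [← Matrix.fromBlocks_toBlocks S]
  rw [halfOmega, Matrix.fromBlocks_transpose, Matrix.fromBlocks_multiply,
    Matrix.fromBlocks_multiply]
  funext i
  cases i <;> simp

theorem even_dotXZ_mulVec_sub {S : Matrix (Fin n ⊕ Fin n) (Fin n ⊕ Fin n) ℤ}
    (hS : S ∈ Matrix.symplecticGroup (Fin n) ℤ) (a : Fin n ⊕ Fin n → ℤ) :
    Even (dotXZ (S *ᵥ a) - dotXZ a - a ⬝ᵥ tbar S) := by
  rw [dotXZ_mulVec_sub, ← diag_transpose_mul_halfOmega_mul_sub]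
  exact even_dotProduct_mulVec_sub_dotProduct_diag (isSymm_transpose_mul_halfOmega_mul_sub hS) a

theorem dotProduct_Omega_mulVec_shiftCoeff {S : Matrix (Fin n ⊕ Fin n) (Fin n ⊕ Fin n) ℤ}
    (hS : S ∈ Matrix.symplecticGroup (Fin n) ℤ) (a : Fin n ⊕ Fin n → ℤ) :
    (S *ᵥ a) ⬝ᵥ (Omega n ℤ *ᵥ shiftCoeff S) = a ⬝ᵥ tbar S := by
  rw [shiftCoeff, Matrix.mulVec_mulVec, Matrix.dotProduct_mulVec, Matrix.vecMul_mulVec,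
    ← Matrix.mul_assoc, ← Matrix.mul_assoc, transpose_mul_Omega_mul hS, Omega_inv, mul_neg,
    Omega_mul_Omega, neg_neg, ← Matrix.dotProduct_mulVec, Matrix.one_mulVec]

theorem realMat_mem_symplecticGroup {S : Matrix (Fin n ⊕ Fin n) (Fin n ⊕ Fin n) ℤ}
    (hS : S ∈ Matrix.symplecticGroup (Fin n) ℤ) :
    realMat S ∈ Matrix.symplecticGroup (Fin n) ℝ :=
  SymplecticGroup.map_mem (S := ℝ) hS (Int.castRingHom ℝ)

theorem realMat_mulVec_realVec (S : Matrix (Fin n ⊕ Fin n) (Fin n ⊕ Fin n) ℤ)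
    (a : Fin n ⊕ Fin n → ℤ) : realMat S *ᵥ realVec a = realVec (S *ᵥ a) :=
  funext fun i => (RingHom.map_mulVec (Int.castRingHom ℝ) S a i).symm

theorem realVec_vecMul_Omega (a : Fin n ⊕ Fin n → ℤ) :
    realVec a ᵥ* Omega n ℝ = realVec (a ᵥ* Omega n ℤ) := by
  funext i
  cases i <;> simp [vecMul_Omega, realVec]

theorem realVec_dotProduct_realVec (a b : Fin n ⊕ Fin n → ℤ) :
    realVec a ⬝ᵥ realVec b = ((a ⬝ᵥ b : ℤ) : ℝ) :=
  (RingHom.map_dotProduct (Int.castRingHom ℝ) a b).symm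

theorem sympl_realVec (a b : Fin n ⊕ Fin n → ℤ) :
    sympl (realVec a) (realVec b) = ((a ⬝ᵥ (Omega n ℤ *ᵥ b) : ℤ) : ℝ) := by
  rw [sympl, Matrix.dotProduct_mulVec, realVec_vecMul_Omega, realVec_dotProduct_realVec,
    ← Matrix.dotProduct_mulVec]

theorem sympl_mulVec_mulVec {S : Matrix (Fin n ⊕ Fin n) (Fin n ⊕ Fin n) ℝ}
    (hS : S ∈ Matrix.symplecticGroup (Fin n) ℝ) (a b : Fin n ⊕ Fin n → ℝ) :
    sympl (S *ᵥ a) (S *ᵥ b) = sympl a b := by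
  rw [sympl, sympl, Matrix.mulVec_mulVec, Matrix.dotProduct_mulVec, Matrix.vecMul_mulVec,
    ← Matrix.dotProduct_mulVec, ← Matrix.mul_assoc, transpose_mul_Omega_mul hS]

end Symplectic

/-! ### Displacement operators on Schwartz functions -/

section Schwartz

variable {E F : Type*} [NormedAddCommGroup E] [NormedSpace ℝ E] [NormedAddCommGroup F]
  [NormedSpace ℝ F]

theorem hasTemperateGrowth_cexp_I_mul :
    Function.HasTemperateGrowth fun t : ℝ => Complex.exp (Complex.I * (t : ℂ)) := by
  have hderiv (k : ℕ) : iteratedDeriv k (fun t : ℝ => Complex.exp (Complex.I * (t : ℂ))) =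
      fun t : ℝ => Complex.I ^ k * Complex.exp (Complex.I * (t : ℂ)) := by
    induction k with
    | zero => simp
    | succ k ih =>
      rw [iteratedDeriv_succ, ih]
      funext t
      have h : HasDerivAt (fun t : ℝ => Complex.I * (t : ℂ)) Complex.I t := by
        simpa using (Complex.ofRealCLM.hasDerivAt (x := t)).const_mul Complex.I
      rw [(h.cexp.const_mul (Complex.I ^ k)).deriv]
      ring
  refine ⟨(contDiff_const.mul Complex.ofRealCLM.contDiff).cexp, fun k => ⟨0, 1, fun t => ?_⟩⟩
  rw [norm_iteratedFDeriv_eq_norm_iteratedDeriv, hderiv]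
  simp [Complex.norm_exp]

theorem exists_one_add_norm_pow_mul_le (f : 𝓢(E, F)) (k : ℕ) :
    ∃ C, ∀ x, (1 + ‖x‖) ^ k * ‖f x‖ ≤ C := by
  refine ⟨2 ^ k * (Finset.Iic (k, 0)).sup (fun m => SchwartzMap.seminorm ℝ m.1 m.2) f, fun x => ?_⟩
  simpa only [norm_iteratedFDeriv_zero] using
    SchwartzMap.one_add_le_sup_seminorm_apply (𝕜 := ℝ) (m := (k, 0)) le_rfl le_rfl f x

theorem exists_one_add_norm_pow_mul_apply_add_smul_le (f : 𝓢(E, F)) (v : E) (k : ℕ) :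
    ∃ C, ∀ (x : E) (s : ℝ), |s| ≤ 1 → (1 + ‖x‖) ^ k * ‖f (x + s • v)‖ ≤ C := by
  obtain ⟨C, hC⟩ := exists_one_add_norm_pow_mul_le f k
  refine ⟨(1 + ‖v‖) ^ k * C, fun x s hs => ?_⟩
  have hx : 1 + ‖x‖ ≤ (1 + ‖v‖) * (1 + ‖x + s • v‖) := by
    have hsub : ‖x‖ ≤ ‖x + s • v‖ + ‖s • v‖ := by
      simpa using norm_sub_le (x + s • v) (s • v)
    have hsmul : ‖s • v‖ ≤ ‖v‖ := by
      rw [norm_smul]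
      exact mul_le_of_le_one_left (norm_nonneg v) hs
    nlinarith [norm_nonneg (x + s • v), norm_nonneg v]
  calc (1 + ‖x‖) ^ k * ‖f (x + s • v)‖
      ≤ ((1 + ‖v‖) * (1 + ‖x + s • v‖)) ^ k * ‖f (x + s • v)‖ := by gcongr
    _ = (1 + ‖v‖) ^ k * ((1 + ‖x + s • v‖) ^ k * ‖f (x + s • v)‖) := by rw [mul_pow, mul_assoc]
    _ ≤ (1 + ‖v‖) ^ k * C := by gcongr; exact hC _

theorem exists_norm_toLp_le [MeasurableSpace E] [OpensMeasurableSpace E]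
    [SecondCountableTopologyEither E F] (p : ENNReal) (μ : Measure E) [hμ : μ.HasTemperateGrowth] :
    ∃ (k : ℕ) (K : ℝ), ∀ (f : 𝓢(E, F)) (C : ℝ), (∀ x, (1 + ‖x‖) ^ k * ‖f x‖ ≤ C) →
      ‖f.toLp p μ‖ ≤ C * K := by
  obtain ⟨k, hk⟩ := Measure.HasTemperateGrowth.exists_eLpNorm_lt_top p hμ
  have hmem : MemLp (fun x : E => (1 + ‖x‖) ^ (-(k : ℝ))) p μ :=
    ⟨(Measurable.pow_const (by fun_prop) _).aestronglyMeasurable, hk⟩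
  refine ⟨k, ‖hmem.toLp _‖, fun f C hC => Lp.norm_le_mul_norm_of_ae_le_mul ?_⟩
  filter_upwards [f.coeFn_toLp p μ, hmem.coeFn_toLp] with x hf hpow
  have hpos : 0 < 1 + ‖x‖ := by positivity
  rw [hf, hpow, Real.norm_of_nonneg (by positivity), Real.rpow_neg hpos.le, Real.rpow_natCast,
    ← div_eq_mul_inv, le_div_iff₀ (by positivity), mul_comm]
  exact hC x

theorem norm_sub_sub_smul_le_of_norm_deriv_deriv_le {f f' f'' : ℝ → F} {C h : ℝ}
    (hf : ∀ s, HasDerivAt f (f' s) s) (hf' : ∀ s, HasDerivAt f' (f'' s) s)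
    (hC : ∀ s, |s| ≤ |h| → ‖f'' s‖ ≤ C) : ‖f h - f 0 - h • f' 0‖ ≤ C * h ^ 2 := by
  have hconv : Convex ℝ (Metric.closedBall (0 : ℝ) |h|) := convex_closedBall _ _
  have hzero : (0 : ℝ) ∈ Metric.closedBall (0 : ℝ) |h| := by simp
  have hself : h ∈ Metric.closedBall (0 : ℝ) |h| := by simp
  have hC0 : 0 ≤ C := (norm_nonneg _).trans (hC 0 (by simp))
  have hfirst (s : ℝ) (hs : s ∈ Metric.closedBall (0 : ℝ) |h|) : ‖f' s - f' 0‖ ≤ C * |h| := by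
    refine (hconv.norm_image_sub_le_of_norm_hasDerivWithin_le
      (fun t _ => (hf' t).hasDerivWithinAt) (fun t ht => hC t (by simpa using ht))
      hzero hs).trans ?_
    gcongr
    simpa using hs
  have hsecond := hconv.norm_image_sub_le_of_norm_hasDerivWithin_le
    (f := fun s => f s - s • f' 0) (fun t _ => ((hf t).sub
      (((hasDerivAt_id t).smul_const (f' 0)).congr_deriv (one_smul _ _))).hasDerivWithinAt)
    hfirst hzero hself
  calc ‖f h - f 0 - h • f' 0‖ = ‖(f h - h • f' 0) - (f 0 - (0 : ℝ) • f' 0)‖ := by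
        rw [zero_smul, sub_zero, sub_right_comm]
    _ ≤ C * |h| * ‖h - 0‖ := hsecond
    _ = C * h ^ 2 := by rw [sub_zero, Real.norm_eq_abs, mul_assoc, ← sq, sq_abs]

end Schwartz

section Displacement

variable {n : ℕ}

theorem hasTemperateGrowth_exp_dispPhase (b : Fin n ⊕ Fin n → ℝ) :
    Function.HasTemperateGrowth
      fun x : Fin n → ℝ => Complex.exp (Complex.I * (dispPhase b x : ℂ)) := by
  refine hasTemperateGrowth_cexp_I_mul.comp (f := dispPhase b) ?_
  have hlin : dispPhase b = fun x => (-∑ j, b (Sum.inr j) •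
      ContinuousLinearMap.proj (R := ℝ) (φ := fun _ : Fin n => ℝ) j) x - dotXZ b / 2 := by
    funext x
    simp [dispPhase]
  rw [hlin]
  exact (ContinuousLinearMap.hasTemperateGrowth _).sub (Function.HasTemperateGrowth.const _)

/-- The `X` part of a phase-space vector, by which `D(b)` translates the wave function. -/
def partX (b : Fin n ⊕ Fin n → ℝ) : Fin n → ℝ := fun j => b (Sum.inl j)

/-- The displacement operator `D(b)` as a map of Schwartz functions. -/
noncomputable def dispSchwartz (b : Fin n ⊕ Fin n → ℝ) (f : 𝓢(Fin n → ℝ, ℂ)) : 𝓢(Fin n → ℝ, ℂ) :=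
  SchwartzMap.smulLeftCLM ℂ (fun x => Complex.exp (Complex.I * (dispPhase b x : ℂ)))
    (SchwartzMap.compSubConstCLM ℂ (-partX b) f)

theorem dispSchwartz_apply (b : Fin n ⊕ Fin n → ℝ) (f : 𝓢(Fin n → ℝ, ℂ)) (x : Fin n → ℝ) :
    dispSchwartz b f x = dispFun b f x := by
  rw [dispSchwartz, SchwartzMap.smulLeftCLM_apply_apply (hasTemperateGrowth_exp_dispPhase b),
    SchwartzMap.compSubConstCLM_apply, sub_neg_eq_add, dispFun, smul_eq_mul]
  rfl

theorem displacement_toLp (b : Fin n ⊕ Fin n → ℝ) (f : 𝓢(Fin n → ℝ, ℂ)) :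
    displacement b (f.toLp 2 volume) = (dispSchwartz b f).toLp 2 volume := by
  refine Lp.ext ((coeFn_displacement b _).trans ?_)
  refine (dispFun_congr b (f.coeFn_toLp 2 volume)).trans ?_
  filter_upwards [(dispSchwartz b f).coeFn_toLp 2 volume] with x hx
  rw [hx, dispSchwartz_apply]

theorem dotXZ_smul (s : ℝ) (b : Fin n ⊕ Fin n → ℝ) : dotXZ (s • b) = s ^ 2 * dotXZ b := by
  simp only [dotXZ, Pi.smul_apply, smul_eq_mul, Finset.mul_sum]
  exact Finset.sum_congr rfl fun j _ => by ring

theorem dispPhase_smul (s : ℝ) (b : Fin n ⊕ Fin n → ℝ) (x : Fin n → ℝ) :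
    dispPhase (s • b) x = -(s * ∑ j, b (Sum.inr j) * x j) - s ^ 2 * dotXZ b / 2 := by
  rw [dispPhase, dotXZ_smul, Finset.mul_sum]
  simp only [Pi.smul_apply, smul_eq_mul, mul_assoc]

theorem dispFun_smul (s : ℝ) (b : Fin n ⊕ Fin n → ℝ) (f : (Fin n → ℝ) → ℂ) (x : Fin n → ℝ) :
    dispFun (s • b) f x =
      Complex.exp (Complex.I * (dispPhase (s • b) x : ℂ)) * f (x + s • partX b) := rfl

theorem sum_inr_mul_add_smul_partX (s : ℝ) (b : Fin n ⊕ Fin n → ℝ) (x : Fin n → ℝ) :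
    ∑ j, b (Sum.inr j) * (x + s • partX b) j = ∑ j, b (Sum.inr j) * x j + s * dotXZ b := by
  simp only [dotXZ, Finset.mul_sum, ← Finset.sum_add_distrib, Pi.add_apply, Pi.smul_apply,
    smul_eq_mul, partX]
  exact Finset.sum_congr rfl fun j _ => by ring

theorem dispSchwartz_zero (f : 𝓢(Fin n → ℝ, ℂ)) : dispSchwartz 0 f = f := by
  ext x
  rw [dispSchwartz_apply, ← zero_smul ℝ (0 : Fin n ⊕ Fin n → ℝ), dispFun_smul, dispPhase_smul]
  simp

theorem dispSchwartz_dispSchwartz (b : Fin n ⊕ Fin n → ℝ) (s t : ℝ) (f : 𝓢(Fin n → ℝ, ℂ)) :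
    dispSchwartz (s • b) (dispSchwartz (t • b) f) = dispSchwartz ((s + t) • b) f := by
  ext x
  rw [dispSchwartz_apply, dispFun_smul, dispSchwartz_apply, dispFun_smul, dispSchwartz_apply,
    dispFun_smul, ← mul_assoc, ← Complex.exp_add, dispPhase_smul, dispPhase_smul, dispPhase_smul,
    sum_inr_mul_add_smul_partX, add_assoc, ← add_smul]
  congr 2
  push_cast
  ring

theorem displacement_toLp_dispSchwartz_neg (b : Fin n ⊕ Fin n → ℝ) (f : 𝓢(Fin n → ℝ, ℂ)) :
    displacement b ((dispSchwartz (-b) f).toLp 2 volume) = f.toLp 2 volume := by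
  have h := dispSchwartz_dispSchwartz b 1 (-1) f
  rw [add_neg_cancel, zero_smul, one_smul, neg_one_smul, dispSchwartz_zero] at h
  rw [displacement_toLp, h]

theorem norm_dispFun (b : Fin n ⊕ Fin n → ℝ) (f : (Fin n → ℝ) → ℂ) (x : Fin n → ℝ) :
    ‖dispFun b f x‖ = ‖f (x + partX b)‖ := by
  rw [dispFun, norm_mul, mul_comm Complex.I, Complex.norm_exp_ofReal_mul_I, one_mul]
  rfl

theorem norm_displacement (b : Fin n ⊕ Fin n → ℝ) (ψ : Modes n) : ‖displacement b ψ‖ = ‖ψ‖ := by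
  rw [Lp.norm_def, Lp.norm_def, ← eLpNorm_comp_measurePreserving (Lp.aestronglyMeasurable ψ)
    (measurePreserving_add_right volume (partX b))]
  congr 1
  refine eLpNorm_congr_norm_ae ?_
  filter_upwards [coeFn_displacement b ψ] with x hx
  rw [hx, norm_dispFun, Function.comp_apply]

theorem inner_displacement (b : Fin n ⊕ Fin n → ℝ) (ψ χ : Modes n) :
    inner ℂ (displacement b ψ) (displacement b χ) = inner ℂ ψ χ :=
  LinearIsometry.inner_map_map
    (⟨(displacement b).toLinearMap, norm_displacement b⟩ : Modes n →ₗᵢ[ℂ] Modes n) ψ χ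

/-! ### Generators of displacements -/

/-- The operator `i bᵀ Ω r̂` on Schwartz functions, which generates `s ↦ D(s b)`. -/
noncomputable def generator (b : Fin n ⊕ Fin n → ℝ) (f : 𝓢(Fin n → ℝ, ℂ)) : 𝓢(Fin n → ℝ, ℂ) :=
  Complex.I • ∑ i, (((b ᵥ* Omega n ℝ) i : ℝ) : ℂ) • quadrature i f

theorem generator_apply (b : Fin n ⊕ Fin n → ℝ) (f : 𝓢(Fin n → ℝ, ℂ)) (x : Fin n → ℝ) :
    generator b f x = fderiv ℝ f x (partX b) -
      Complex.I * ((∑ j, b (Sum.inr j) * x j : ℝ) : ℂ) * f x := by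
  have hpartX : partX b = ∑ j, b (Sum.inl j) • (Pi.single j 1 : Fin n → ℝ) := by
    funext k
    simp [partX, Finset.sum_apply, Pi.single_apply]
  rw [hpartX, map_sum, generator, _root_.smul_apply, _root_.sum_apply, Fintype.sum_sum_type]
  simp only [_root_.smul_apply, quadrature_inl_apply, quadrature_inr_apply, vecMul_Omega,
    Sum.elim_inl, Sum.elim_inr, Pi.neg_apply, Function.comp_apply, smul_eq_mul, map_smul]
  rw [mul_add, add_comm, sub_eq_add_neg]
  congr 1
  · rw [Finset.mul_sum]
    refine Finset.sum_congr rfl fun j _ => ?_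
    rw [f.differentiableAt.lineDeriv_eq_fderiv, Complex.real_smul]
    linear_combination (-(b (Sum.inl j) : ℂ) * fderiv ℝ f x (Pi.single j 1)) * Complex.I_sq
  · push_cast
    rw [Finset.mul_sum, Finset.mul_sum, Finset.sum_mul, ← Finset.sum_neg_distrib]
    exact Finset.sum_congr rfl fun j _ => by ring

theorem hasDerivAt_dispPhase_smul (b : Fin n ⊕ Fin n → ℝ) (x : Fin n → ℝ) (s : ℝ) :
    HasDerivAt (fun s : ℝ => dispPhase (s • b) x)
      (-∑ j, b (Sum.inr j) * (x + s • partX b) j) s := by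
  simp only [dispPhase_smul, sum_inr_mul_add_smul_partX]
  refine ((hasDerivAt_mul_const (∑ j, b (Sum.inr j) * x j)).neg.sub
    (((hasDerivAt_pow 2 s).mul_const (dotXZ b)).div_const 2)).congr_deriv ?_
  push_cast
  ring

theorem hasDerivAt_dispFun_smul (b : Fin n ⊕ Fin n → ℝ) (f : 𝓢(Fin n → ℝ, ℂ)) (x : Fin n → ℝ)
    (s : ℝ) :
    HasDerivAt (fun s : ℝ => dispFun (s • b) f x) (dispFun (s • b) (generator b f) x) s := by
  have hline : HasDerivAt (fun s : ℝ => x + s • partX b) (partX b) s := by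
    simpa using ((hasDerivAt_id s).smul_const (partX b)).const_add x
  have hcomp : HasDerivAt (fun s : ℝ => f (x + s • partX b))
      (fderiv ℝ f (x + s • partX b) (partX b)) s :=
    f.differentiableAt.hasFDerivAt.comp_hasDerivAt s hline
  refine (((hasDerivAt_dispPhase_smul b x s).ofReal_comp.const_mul Complex.I).cexp.mul
    hcomp).congr_deriv ?_
  rw [dispFun_smul, generator_apply]
  push_cast
  ring

theorem norm_dispFun_sub_sub_le (b : Fin n ⊕ Fin n → ℝ) (f : 𝓢(Fin n → ℝ, ℂ)) (x : Fin n → ℝ)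
    {C h : ℝ} (hC : ∀ s : ℝ, |s| ≤ |h| → ‖generator b (generator b f) (x + s • partX b)‖ ≤ C) :
    ‖dispFun (h • b) f x - f x - h • generator b f x‖ ≤ C * h ^ 2 := by
  have hzero (g : 𝓢(Fin n → ℝ, ℂ)) : dispFun ((0 : ℝ) • b) g x = g x := by
    rw [zero_smul, ← dispSchwartz_apply, dispSchwartz_zero]
  have h := norm_sub_sub_smul_le_of_norm_deriv_deriv_le (hasDerivAt_dispFun_smul b f x)
    (hasDerivAt_dispFun_smul b (generator b f) x)
    (fun s hs => (norm_dispFun _ _ _).trans_le (hC s hs))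
  rwa [hzero, hzero] at h

theorem exists_norm_toLp_dispSchwartz_sub_sub_le (b : Fin n ⊕ Fin n → ℝ) (f : 𝓢(Fin n → ℝ, ℂ)) :
    ∃ C, ∀ h : ℝ, |h| ≤ 1 → ‖(dispSchwartz (h • b) f).toLp 2 (volume : Measure (Fin n → ℝ)) -
      f.toLp 2 volume - h • (generator b f).toLp 2 volume‖ ≤ C * h ^ 2 := by
  obtain ⟨k, K, hK⟩ := exists_norm_toLp_le (F := ℂ) 2 (volume : Measure (Fin n → ℝ))
  obtain ⟨C, hC⟩ :=
    exists_one_add_norm_pow_mul_apply_add_smul_le (generator b (generator b f)) (partX b) k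
  refine ⟨C * K, fun h hh => ?_⟩
  have hpointwise (x : Fin n → ℝ) :
      (1 + ‖x‖) ^ k * ‖(dispSchwartz (h • b) f - f - h • generator b f) x‖ ≤ C * h ^ 2 := by
    have hpos : 0 < (1 + ‖x‖) ^ k := by positivity
    have htaylor := norm_dispFun_sub_sub_le b f x (C := C / (1 + ‖x‖) ^ k) (h := h) fun s hs =>
      (le_div_iff₀' hpos).2 (hC x s (hs.trans hh))
    rwa [div_mul_eq_mul_div, le_div_iff₀' hpos, ← dispSchwartz_apply] at htaylor
  have hnorm := hK _ _ hpointwise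
  simp only [← SchwartzMap.toLpCLM_apply (𝕜 := ℝ), map_sub, map_smul] at hnorm ⊢
  exact hnorm.trans_eq (by ring)

theorem hasDerivAt_toLp_dispSchwartz_smul (b : Fin n ⊕ Fin n → ℝ) (f : 𝓢(Fin n → ℝ, ℂ)) (s : ℝ) :
    HasDerivAt (fun s : ℝ => (dispSchwartz (s • b) f).toLp 2 volume)
      ((generator b (dispSchwartz (s • b) f)).toLp 2 volume) s := by
  have hzero (g : 𝓢(Fin n → ℝ, ℂ)) :
      HasDerivAt (fun s : ℝ => (dispSchwartz (s • b) g).toLp 2 volume)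
        ((generator b g).toLp 2 volume) 0 := by
    obtain ⟨C, hC⟩ := exists_norm_toLp_dispSchwartz_sub_sub_le b g
    rw [hasDerivAt_iff_isLittleO_nhds_zero]
    refine (Asymptotics.IsBigO.of_bound C ?_).trans_isLittleO
      (Asymptotics.isLittleO_pow_id one_lt_two)
    filter_upwards [Metric.closedBall_mem_nhds (0 : ℝ) one_pos] with h hh
    rw [zero_add, zero_smul, dispSchwartz_zero, norm_pow, Real.norm_eq_abs, sq_abs]
    exact hC h (by simpa using hh)
  have h := hzero (dispSchwartz (s • b) f)
  rw [← sub_self s] at h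
  simpa only [dispSchwartz_dispSchwartz, sub_add_cancel] using h.comp_sub_const s s

theorem inner_generator_add_inner_generator (b : Fin n ⊕ Fin n → ℝ) (f g : 𝓢(Fin n → ℝ, ℂ)) :
    inner ℂ (f.toLp 2 (volume : Measure (Fin n → ℝ))) ((generator b g).toLp 2 volume) +
      inner ℂ ((generator b f).toLp 2 (volume : Measure (Fin n → ℝ))) (g.toLp 2 volume) = 0 := by
  have h := (hasDerivAt_toLp_dispSchwartz_smul b f 0).inner ℂ
    (hasDerivAt_toLp_dispSchwartz_smul b g 0)
  simp only [← displacement_toLp, inner_displacement, zero_smul, dispSchwartz_zero] at h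
  simpa only [displacement_toLp, dispSchwartz_zero] using h.unique (hasDerivAt_const _ _)

/-! ### Covariance of the displacement operators -/

variable {S : Matrix (Fin n ⊕ Fin n) (Fin n ⊕ Fin n) ℝ} {U : Modes n →L[ℂ] Modes n}

theorem IsGaussianUnitary.apply_generator (hU : IsGaussianUnitary S U)
    (hS : S ∈ Matrix.symplecticGroup (Fin n) ℝ) (b : Fin n ⊕ Fin n → ℝ) (f : 𝓢(Fin n → ℝ, ℂ)) :
    ∃ g : 𝓢(Fin n → ℝ, ℂ), U (f.toLp 2 volume) = g.toLp 2 volume ∧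
      U ((generator (S *ᵥ b) f).toLp 2 volume) = (generator b g).toLp 2 volume := by
  obtain ⟨g, hg, hquad⟩ := hU.quadratures f
  have hb : b ᵥ* Omega n ℝ = (S *ᵥ b) ᵥ* Omega n ℝ ᵥ* S := by
    rw [Matrix.vecMul_mulVec, Matrix.vecMul_vecMul, transpose_mul_Omega_mul hS]
  refine ⟨g, hg, ?_⟩
  simp only [← SchwartzMap.toLpCLM_apply (𝕜 := ℂ)] at hquad ⊢
  simp only [generator, map_smul, map_sum, hquad, hb]
  congr 1
  simp only [Finset.smul_sum, smul_smul]
  rw [Finset.sum_comm]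
  refine Finset.sum_congr rfl fun k _ => ?_
  rw [← Finset.sum_smul]
  congr 1
  simp [vecMul, dotProduct]

theorem IsGaussianUnitary.inner_displacement_apply_displacement (hU : IsGaussianUnitary S U)
    (hS : S ∈ Matrix.symplecticGroup (Fin n) ℝ) (b : Fin n ⊕ Fin n → ℝ) (f g : 𝓢(Fin n → ℝ, ℂ)) :
    inner ℂ (displacement b (g.toLp 2 volume)) (U (displacement (S *ᵥ b) (f.toLp 2 volume))) =
      inner ℂ (g.toLp 2 volume) (U (f.toLp 2 volume)) := by
  have hderiv (s : ℝ) : HasDerivAt (fun s : ℝ => inner ℂ ((dispSchwartz (s • b) g).toLp 2 volume)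
      (U ((dispSchwartz (s • S *ᵥ b) f).toLp 2 volume))) 0 s := by
    obtain ⟨f', hf', hgen⟩ := hU.apply_generator hS b (dispSchwartz (s • S *ᵥ b) f)
    refine ((hasDerivAt_toLp_dispSchwartz_smul b g s).inner ℂ
      ((U.restrictScalars ℝ).hasFDerivAt.comp_hasDerivAt s
        (hasDerivAt_toLp_dispSchwartz_smul (S *ᵥ b) f s))).congr_deriv ?_
    simp only [Function.comp_apply, ContinuousLinearMap.coe_restrictScalars']
    rw [hf', hgen]
    exact inner_generator_add_inner_generator b _ f'
  have hconst := is_const_of_deriv_eq_zero (fun s => (hderiv s).differentiableAt)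
    (fun s => (hderiv s).deriv) 1 0
  simpa only [one_smul, zero_smul, dispSchwartz_zero, ← displacement_toLp] using hconst

theorem denseRange_toLp_two_volume :
    DenseRange fun f : 𝓢(Fin n → ℝ, ℂ) => f.toLp 2 (volume : Measure (Fin n → ℝ)) :=
  SchwartzMap.denseRange_toLpCLM (by simp)

theorem IsGaussianUnitary.mul_displacement (hU : IsGaussianUnitary S U)
    (hS : S ∈ Matrix.symplecticGroup (Fin n) ℝ) (b : Fin n ⊕ Fin n → ℝ) :
    U * displacement (S *ᵥ b) = displacement b * U := by
  refine ContinuousLinearMap.ext fun ψ => congrFun (denseRange_toLp_two_volume.equalizer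
    (U * displacement (S *ᵥ b)).continuous (displacement b * U).continuous (funext fun f => ?_)) ψ
  refine denseRange_toLp_two_volume.eq_of_inner_right ℂ fun g => ?_
  change inner ℂ (g.toLp 2 volume) (U (displacement (S *ᵥ b) (f.toLp 2 volume))) =
    inner ℂ (g.toLp 2 volume) (displacement b (U (f.toLp 2 volume)))
  rw [← displacement_toLp_dispSchwartz_neg b g, hU.inner_displacement_apply_displacement hS,
    inner_displacement]

end Displacement

/-! ### Covariance of the Wigner function -/

section Covariance

variable {n d : ℕ} {S : Matrix (Fin n ⊕ Fin n) (Fin n ⊕ Fin n) ℤ} {U ρ : Modes n →L[ℂ] Modes n}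

theorem ell_pos (hd : 0 < d) : 0 < ell d := by
  unfold ell
  positivity

theorem IsGaussianUnitary.star_mul_logicalShift_mul (hU : IsGaussianUnitary (realMat S) U)
    (hS : S ∈ Matrix.symplecticGroup (Fin n) ℤ) (a : Fin n ⊕ Fin n → ℤ) :
    star U * logicalShift d (realVec a) * U = logicalShift d (realVec (S *ᵥ a)) := by
  rw [logicalShift, logicalShift, mul_assoc,
    ← hU.mul_displacement (realMat_mem_symplecticGroup hS), ← mul_assoc,
    Unitary.star_mul_self_of_mem hU.unitary, one_mul, Matrix.mulVec_neg, Matrix.mulVec_smul,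
    realMat_mulVec_realVec]

theorem IsGaussianUnitary.opTrace_conj_mul_logicalShift (hU : IsGaussianUnitary (realMat S) U)
    (hS : S ∈ Matrix.symplecticGroup (Fin n) ℤ) (hρ : IsTraceClass ρ) (a : Fin n ⊕ Fin n → ℤ) :
    opTrace (U * ρ * star U * logicalShift d (realVec a)) =
      opTrace (ρ * logicalShift d (realVec (S *ᵥ a))) := by
  rw [← hU.star_mul_logicalShift_mul hS, ← (hρ.mul_right _).opTrace_conj hU.unitary]
  congr 1
  simp only [mul_assoc, Unitary.mul_star_self_of_mem hU.unitary, mul_one]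

theorem sympl_realVec_mulVec_sub_shift (hS : S ∈ Matrix.symplecticGroup (Fin n) ℤ)
    (η : Fin n ⊕ Fin n → ℝ) (a : Fin n ⊕ Fin n → ℤ) :
    sympl (realVec (S *ᵥ a)) (realMat S *ᵥ η - shift d S) =
      sympl (realVec a) η - Real.pi / ell d * ((a ⬝ᵥ tbar S : ℤ) : ℝ) := by
  have hη : sympl (realVec (S *ᵥ a)) (realMat S *ᵥ η) = sympl (realVec a) η := by
    rw [← realMat_mulVec_realVec, sympl_mulVec_mulVec (realMat_mem_symplecticGroup hS)]
  have hshift : sympl (realVec (S *ᵥ a)) (shift d S) =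
      Real.pi / ell d * ((a ⬝ᵥ tbar S : ℤ) : ℝ) := by
    rw [← dotProduct_Omega_mulVec_shiftCoeff hS a, ← sympl_realVec, shift, sympl, sympl,
      Matrix.mulVec_smul, dotProduct_smul, smul_eq_mul]
  rw [← hη, ← hshift]
  simp only [sympl, Matrix.mulVec_sub, dotProduct_sub]

theorem exp_sympl_add_dotXZ_mulVec (hd : 0 < d) (hS : S ∈ Matrix.symplecticGroup (Fin n) ℤ)
    (η : Fin n ⊕ Fin n → ℝ) (a : Fin n ⊕ Fin n → ℤ) :
    Complex.exp (Complex.I * ((ell d * sympl (realVec a) η : ℝ) : ℂ)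
        + Complex.I * Real.pi * ((dotXZ a : ℤ) : ℂ)) =
      Complex.exp (Complex.I * ((ell d * sympl (realVec (S *ᵥ a))
          (realMat S *ᵥ η - shift d S) : ℝ) : ℂ)
        + Complex.I * Real.pi * ((dotXZ (S *ᵥ a) : ℤ) : ℂ)) := by
  obtain ⟨m, hm⟩ := even_dotXZ_mulVec_sub hS a
  have hdotXZ : dotXZ (S *ᵥ a) = dotXZ a + a ⬝ᵥ tbar S + 2 * m := by linarith
  have hell : ((ell d : ℝ) : ℂ) ≠ 0 := Complex.ofReal_ne_zero.2 (ell_pos hd).ne'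
  rw [sympl_realVec_mulVec_sub_shift hS, hdotXZ, Complex.exp_eq_exp_iff_exists_int]
  refine ⟨-m, ?_⟩
  push_cast
  field_simp
  ring

theorem wignerTerm_conj (hd : 0 < d) (hS : S ∈ Matrix.symplecticGroup (Fin n) ℤ)
    (hU : IsGaussianUnitary (realMat S) U) (hρ : IsTraceClass ρ) (η : Fin n ⊕ Fin n → ℝ)
    (a : Fin n ⊕ Fin n → ℤ) :
    wignerTerm d (U * ρ * star U) η a =
      wignerTerm d ρ (realMat S *ᵥ η - shift d S) (S *ᵥ a) := by
  rw [wignerTerm, wignerTerm, hU.opTrace_conj_mul_logicalShift hS hρ,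
    exp_sympl_add_dotXZ_mulVec hd hS]

/-- The permutation `a ↦ S a` of the index lattice of the Wigner series. -/
noncomputable def latticeEquiv (hS : S ∈ Matrix.symplecticGroup (Fin n) ℤ) :
    (Fin n ⊕ Fin n → ℤ) ≃ (Fin n ⊕ Fin n → ℤ) :=
  have hdet := SymplecticGroup.symplectic_det hS
  (Matrix.toLin'OfInv (Matrix.nonsing_inv_mul S hdet) (Matrix.mul_nonsing_inv S hdet)).toEquiv

theorem zakGrossWigner_conj (hd : 0 < d) (hS : S ∈ Matrix.symplecticGroup (Fin n) ℤ)
    (hU : IsGaussianUnitary (realMat S) U) (hρ : IsTraceClass ρ) (η : Fin n ⊕ Fin n → ℝ) :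
    (Summable (wignerTerm d (U * ρ * star U) η) ↔
        Summable (wignerTerm d ρ (realMat S *ᵥ η - shift d S))) ∧
      zakGrossWigner d (U * ρ * star U) η = zakGrossWigner d ρ (realMat S *ᵥ η - shift d S) := by
  have hterm : wignerTerm d (U * ρ * star U) η =
      wignerTerm d ρ (realMat S *ᵥ η - shift d S) ∘ latticeEquiv hS :=
    funext fun a => wignerTerm_conj hd hS hU hρ η a
  rw [zakGrossWigner, zakGrossWigner, hterm]
  exact ⟨(latticeEquiv hS).summable_iff, (latticeEquiv hS).tsum_eq _⟩

end Covariance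

/-! ### Convergence of the smeared series -/

section Smeared

open scoped FourierTransform in
theorem exists_norm_pow_mul_fourierIntegral_le {ι : Type*} [Fintype ι] (φ : 𝓢(ι → ℝ, ℂ)) (k : ℕ) :
    ∃ C : ℝ, ∀ w : ι → ℝ,
      ‖w‖ ^ k * ‖∫ η, Complex.exp (((-2 * Real.pi * (w ⬝ᵥ η) : ℝ) : ℂ) * Complex.I) * φ η‖ ≤ C := by
  let φ' : 𝓢(EuclideanSpace ℝ ι, ℂ) :=
    SchwartzMap.compCLMOfContinuousLinearEquiv ℝ (EuclideanSpace.equiv ι ℝ) φ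
  obtain ⟨C, -, hC⟩ := (𝓕 φ').decay k 0
  refine ⟨C, fun w => ?_⟩
  have hdecay := hC (WithLp.toLp 2 w)
  have hint : ∫ v : EuclideanSpace ℝ ι, Complex.exp
        (((-2 * Real.pi * inner ℝ v (WithLp.toLp 2 w) : ℝ) : ℂ) * Complex.I) • φ' v =
      ∫ η, Complex.exp (((-2 * Real.pi * (w ⬝ᵥ η) : ℝ) : ℂ) * Complex.I) * φ η := by
    rw [← (PiLp.volume_preserving_toLp ι).integral_comp
      (MeasurableEquiv.toLp 2 (ι → ℝ)).measurableEmbedding]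
    rfl
  rw [norm_iteratedFDeriv_zero, SchwartzMap.fourier_coe, Real.fourier_eq', hint] at hdecay
  refine le_trans ?_ hdecay
  gcongr
  exact (pi_norm_le_iff_of_nonneg (norm_nonneg _)).2 fun i => PiLp.norm_apply_le (WithLp.toLp 2 w) i

theorem exists_summable_inv_norm_intCast_pow (ι : Type*) [Fintype ι] :
    ∃ k : ℕ, Summable fun m : ι → ℤ => ‖fun i => (m i : ℝ)‖⁻¹ ^ k := by
  classical
  let L := Submodule.span ℤ (Set.range (Pi.basisFun ℝ ι))
  have hmem (m : ι → ℤ) : (fun i => (m i : ℝ)) ∈ L := by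
    have hsum : (fun i => (m i : ℝ)) = ∑ i, m i • Pi.basisFun ℝ ι i := by
      funext j
      simp [Finset.sum_apply, Pi.single_apply]
    rw [hsum]
    exact Submodule.sum_mem _ fun i _ => Submodule.smul_mem _ _ (Submodule.subset_span ⟨i, rfl⟩)
  have hinj : Function.Injective fun m : ι → ℤ => (⟨fun i => (m i : ℝ), hmem m⟩ : L) :=
    fun m m' h => funext fun i => Int.cast_injective (congrFun (congrArg Subtype.val h) i)
  refine ⟨Module.finrank ℤ L + 1, ?_⟩
  have hL : Summable fun z : L => ‖(z : ι → ℝ)‖⁻¹ ^ (Module.finrank ℤ L + 1) :=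
    ZLattice.summable_norm_pow_inv L (Module.finrank ℤ L + 1) (Nat.lt_succ_self _)
  simpa only [Function.comp_def] using hL.comp_injective hinj

theorem summable_norm_integral_exp_mul {ι : Type*} [Fintype ι] (φ : 𝓢(ι → ℝ, ℂ)) {c : ℝ}
    (hc : c ≠ 0) :
    Summable fun m : ι → ℤ =>
      ‖∫ η, Complex.exp (Complex.I * ((c * ((fun i => (m i : ℝ)) ⬝ᵥ η) : ℝ) : ℂ)) * φ η‖ := by
  obtain ⟨k, hk⟩ := exists_summable_inv_norm_intCast_pow ι
  obtain ⟨C, hC⟩ := exists_norm_pow_mul_fourierIntegral_le φ k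
  let s : ℝ := -c / (2 * Real.pi)
  have hs : 0 < |s| := abs_pos.2 (div_ne_zero (neg_ne_zero.2 hc) (by positivity))
  refine Summable.of_norm_bounded_eventually (hk.mul_left (C / |s| ^ k)) ?_
  filter_upwards [(Set.finite_singleton (0 : ι → ℤ)).compl_mem_cofinite] with m hm
  have hpos : 0 < ‖fun i => (m i : ℝ)‖ := norm_pos_iff.2 fun h =>
    hm (funext fun i => Int.cast_injective (α := ℝ) (by simpa using congrFun h i))
  have hphase (η : ι → ℝ) :
      ((-2 * Real.pi * ((s • fun i => (m i : ℝ)) ⬝ᵥ η) : ℝ) : ℂ) * Complex.I =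
      Complex.I * ((c * ((fun i => (m i : ℝ)) ⬝ᵥ η) : ℝ) : ℂ) := by
    rw [smul_dotProduct, smul_eq_mul, mul_comm Complex.I]
    congr 2
    simp only [s]
    field_simp
  have hdecay := hC (s • fun i => (m i : ℝ))
  simp only [hphase, norm_smul, mul_pow, Real.norm_eq_abs s] at hdecay
  rw [norm_norm, inv_pow, ← div_eq_mul_inv, div_div, le_div_iff₀ (by positivity), mul_comm]
  exact hdecay

variable {n d : ℕ} {ρ : Modes n →L[ℂ] Modes n}

theorem norm_logicalShift_le_one (a : Fin n ⊕ Fin n → ℝ) : ‖logicalShift d a‖ ≤ 1 :=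
  ContinuousLinearMap.opNorm_le_bound _ zero_le_one fun ψ => by
    rw [logicalShift, norm_displacement, one_mul]

theorem vecMul_Omega_injective :
    Function.Injective fun a : Fin n ⊕ Fin n → ℤ => a ᵥ* Omega n ℤ := by
  intro a a' h
  simpa only [Matrix.vecMul_vecMul, Omega_mul_Omega, Matrix.vecMul_neg, Matrix.vecMul_one,
    neg_inj] using congrArg (fun v => v ᵥ* Omega n ℤ) h

theorem norm_smearedTerm (φ : (Fin n ⊕ Fin n → ℝ) → ℂ) (a : Fin n ⊕ Fin n → ℤ) :
    ‖smearedTerm d ρ φ a‖ = ‖(1 / (2 * Real.pi) ^ n : ℂ)‖ *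
      ‖opTrace (ρ * logicalShift d (realVec a))‖ *
      ‖∫ η, Complex.exp (Complex.I *
        ((ell d * (realVec (a ᵥ* Omega n ℤ) ⬝ᵥ η) : ℝ) : ℂ)) * φ η‖ := by
  have hterm (η : Fin n ⊕ Fin n → ℝ) : wignerTerm d ρ η a * φ η =
      ((1 / (2 * Real.pi) ^ n : ℂ) * Complex.exp ((Real.pi * (dotXZ a : ℤ) : ℝ) * Complex.I) *
        opTrace (ρ * logicalShift d (realVec a))) *
      (Complex.exp (Complex.I * ((ell d * (realVec (a ᵥ* Omega n ℤ) ⬝ᵥ η) : ℝ) : ℂ)) * φ η) := by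
    rw [wignerTerm, Complex.exp_add, sympl, Matrix.dotProduct_mulVec, realVec_vecMul_Omega]
    push_cast
    ring_nf
  simp only [smearedTerm, hterm]
  rw [integral_const_mul, norm_mul, norm_mul, norm_mul, Complex.norm_exp_ofReal_mul_I, mul_one]

theorem summable_smearedTerm (hd : 0 < d) (hρ : IsTraceClass ρ)
    (φ : 𝓢(Fin n ⊕ Fin n → ℝ, ℂ)) : Summable (smearedTerm d ρ φ) := by
  obtain ⟨C, hC⟩ := hρ.exists_norm_opTrace_mul_le
  have hsum := (summable_norm_integral_exp_mul φ (ell_pos hd).ne').comp_injective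
    vecMul_Omega_injective
  refine Summable.of_norm_bounded (hsum.mul_left (‖(1 / (2 * Real.pi) ^ n : ℂ)‖ * |C|))
    fun a => ?_
  have htrace : ‖opTrace (ρ * logicalShift d (realVec a))‖ ≤ |C| := by
    refine (hC _).trans ((le_abs_self _).trans ?_)
    rw [abs_mul, abs_norm]
    exact mul_le_of_le_one_right (abs_nonneg C) (norm_logicalShift_le_one _)
  rw [norm_smearedTerm]
  gcongr
  rfl

/-! ### Covariance of the smeared Wigner function -/

theorem integral_comp_mulVec_sub {ι E : Type*} [Fintype ι] [DecidableEq ι] [NormedAddCommGroup E]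
    [NormedSpace ℝ E] {S : Matrix ι ι ℝ} (hS : |S.det| = 1) (t : ι → ℝ) (f : (ι → ℝ) → E) :
    ∫ η, f (S *ᵥ η - t) = ∫ ξ, f ξ := by
  have hdet : S.det ≠ 0 := fun h => by simp [h] at hS
  have hmp : MeasurePreserving (Matrix.toLin' S) volume volume := by
    refine ⟨(LinearMap.continuous_of_finiteDimensional _).measurable, ?_⟩
    rw [Real.map_matrix_volume_pi_eq_smul_volume_pi hdet, abs_inv, hS]
    simp
  have hemb : MeasurableEmbedding (Matrix.toLin' S) :=
    (LinearMap.continuous_of_finiteDimensional _).measurableEmbedding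
      (Matrix.mulVec_injective_of_isUnit ((Matrix.isUnit_iff_isUnit_det _).2 hdet.isUnit))
  calc ∫ η, f (S *ᵥ η - t) = ∫ ξ, f (ξ - t) := hmp.integral_comp hemb fun ξ => f (ξ - t)
    _ = ∫ ξ, f ξ := integral_sub_right_eq_self f t

theorem exists_schwartz_eq_comp_mulVec_add {ι F : Type*} [Fintype ι] [DecidableEq ι]
    [NormedAddCommGroup F] [NormedSpace ℝ F] {S : Matrix ι ι ℝ} (hS : IsUnit S.det) (t : ι → ℝ)
    (φ : 𝓢(ι → ℝ, F)) : ∃ ψ : 𝓢(ι → ℝ, F), ∀ ξ, ψ ξ = φ (S⁻¹ *ᵥ (ξ + t)) := by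
  let e := (Matrix.toLin'OfInv (Matrix.mul_nonsing_inv S hS)
    (Matrix.nonsing_inv_mul S hS)).toContinuousLinearEquiv
  refine ⟨SchwartzMap.compSubConstCLM ℝ (-t)
    (SchwartzMap.compCLMOfContinuousLinearEquiv ℝ e φ), fun ξ => ?_⟩
  rw [SchwartzMap.compSubConstCLM_apply, sub_neg_eq_add]
  rfl

variable {S : Matrix (Fin n ⊕ Fin n) (Fin n ⊕ Fin n) ℤ} {U : Modes n →L[ℂ] Modes n}

theorem smearedTerm_conj (hd : 0 < d) (hS : S ∈ Matrix.symplecticGroup (Fin n) ℤ)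
    (hU : IsGaussianUnitary (realMat S) U) (hρ : IsTraceClass ρ)
    (φ : (Fin n ⊕ Fin n → ℝ) → ℂ) (a : Fin n ⊕ Fin n → ℤ) :
    smearedTerm d (U * ρ * star U) φ a =
      smearedTerm d ρ (fun ξ => φ ((realMat S)⁻¹ *ᵥ (ξ + shift d S))) (S *ᵥ a) := by
  have hS' := realMat_mem_symplecticGroup hS
  refine Eq.trans ?_ (integral_comp_mulVec_sub (S := realMat S)
    (by rw [SymplecticGroup.det_eq_one hS', abs_one]) (shift d S) _)
  refine integral_congr_ae (Filter.Eventually.of_forall fun η => ?_)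
  beta_reduce
  rw [wignerTerm_conj hd hS hU hρ, sub_add_cancel, Matrix.mulVec_mulVec,
    Matrix.nonsing_inv_mul _ (SymplecticGroup.symplectic_det hS'), Matrix.one_mulVec]

theorem smearedWigner_conj (hd : 0 < d) (hS : S ∈ Matrix.symplecticGroup (Fin n) ℤ)
    (hU : IsGaussianUnitary (realMat S) U) (hρ : IsTraceClass ρ) (φ : 𝓢(Fin n ⊕ Fin n → ℝ, ℂ)) :
    Summable (smearedTerm d (U * ρ * star U) φ) ∧
      Summable (smearedTerm d ρ (fun ξ => φ ((realMat S)⁻¹ *ᵥ (ξ + shift d S)))) ∧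
      smearedWigner d (U * ρ * star U) φ =
        smearedWigner d ρ (fun ξ => φ ((realMat S)⁻¹ *ᵥ (ξ + shift d S))) := by
  have hterm : smearedTerm d (U * ρ * star U) φ =
      smearedTerm d ρ (fun ξ => φ ((realMat S)⁻¹ *ᵥ (ξ + shift d S))) ∘ latticeEquiv hS :=
    funext fun a => smearedTerm_conj hd hS hU hρ φ a
  obtain ⟨ψ, hψ⟩ := exists_schwartz_eq_comp_mulVec_add
    (SymplecticGroup.symplectic_det (realMat_mem_symplecticGroup hS)) (shift d S) φ
  have hsum : Summable (smearedTerm d ρ (fun ξ => φ ((realMat S)⁻¹ *ᵥ (ξ + shift d S)))) := by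
    rw [← funext hψ]
    exact summable_smearedTerm hd hρ ψ
  rw [smearedWigner, smearedWigner, hterm]
  exact ⟨(latticeEquiv hS).summable_iff.2 hsum, hsum, (latticeEquiv hS).tsum_eq _⟩

end Smeared

/-! ### Correctness and cost of programs -/

section Programs

theorem bits_le_bits {z B : ℤ} (h : |z| ≤ B) : bits z ≤ bits B :=
  Nat.succ_le_succ (Nat.size_le_size (by zify; exact h.trans (le_abs_self B)))

theorem bits_le_of_abs_le_two_pow {z : ℤ} {m : ℕ} (h : |z| ≤ 2 ^ m) : bits z ≤ m + 2 := by
  have hz : z.natAbs ≤ 2 ^ m := by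
    zify
    exact h
  exact Nat.succ_le_succ (Nat.size_le.2 (hz.trans_lt (Nat.pow_lt_pow_succ one_lt_two)))

theorem abs_lt_two_pow_bits (z : ℤ) : |z| < 2 ^ bits z := by
  have h : z.natAbs < 2 ^ bits z := Nat.size_le.1 (Nat.le_succ _)
  zify at h
  exact h

theorem State.reg_setReg (σ : State) (r r' : ℕ) (z : ℤ) :
    (σ.setReg r z).reg r' = if r' = r then z else σ.reg r' :=
  Function.update_apply _ _ _ _

theorem State.arr_setReg (σ : State) (r : ℕ) (z : ℤ) : (σ.setReg r z).arr = σ.arr := rfl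

theorem State.reg_setArr (σ : State) (k i : ℕ) (z : ℤ) : (σ.setArr k i z).reg = σ.reg := rfl

theorem State.arr_setArr (σ : State) (k i k' i' : ℕ) (z : ℤ) :
    (σ.setArr k i z).arr k' i' = if k' = k ∧ i' = i then z else σ.arr k' i' := by
  by_cases hk : k' = k
  · subst hk
    simp [State.setArr, Function.update_apply]
  · simp [State.setArr, hk]

/-- The frame condition of a program run from `σ` to `τ`: the registers below `b` and the arrays
outside of `K` are unchanged. -/
structure State.EqOff (b : ℕ) (K : Set ℕ) (σ τ : State) : Prop where
  reg : ∀ r < b, τ.reg r = σ.reg r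
  arr : ∀ k ∉ K, τ.arr k = σ.arr k

theorem State.EqOff.refl (b : ℕ) (K : Set ℕ) (σ : State) : σ.EqOff b K σ :=
  ⟨fun _ _ => rfl, fun _ _ => rfl⟩

theorem State.eqOff_setReg {b r : ℕ} {K : Set ℕ} {σ τ : State} (hr : b ≤ r) (z : ℤ) :
    σ.EqOff b K (τ.setReg r z) ↔ σ.EqOff b K τ := by
  have hreg (s : ℕ) (hs : s < b) : (τ.setReg r z).reg s = τ.reg s := by
    rw [State.reg_setReg, if_neg (hs.trans_le hr).ne]
  exact ⟨fun h => ⟨fun s hs => (hreg s hs).symm.trans (h.reg s hs), h.arr⟩,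
    fun h => ⟨fun s hs => (hreg s hs).trans (h.reg s hs), h.arr⟩⟩

theorem State.eqOff_setArr {b k : ℕ} {K : Set ℕ} {σ τ : State} (hk : k ∈ K) (i : ℕ) (z : ℤ) :
    σ.EqOff b K (τ.setArr k i z) ↔ σ.EqOff b K τ := by
  have harr (k' : ℕ) (hk' : k' ∉ K) : (τ.setArr k i z).arr k' = τ.arr k' :=
    Function.update_of_ne (ne_of_mem_of_not_mem hk hk').symm _ _
  exact ⟨fun h => ⟨h.reg, fun k' hk' => (harr k' hk').symm.trans (h.arr k' hk')⟩,
    fun h => ⟨h.reg, fun k' hk' => (harr k' hk').trans (h.arr k' hk')⟩⟩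

theorem State.EqOff.trans {b b' : ℕ} {K K' : Set ℕ} {σ τ υ : State} (h : σ.EqOff b K τ)
    (h' : τ.EqOff b' K' υ) (hb : b ≤ b') (hK : K' ⊆ K) : σ.EqOff b K υ :=
  ⟨fun r hr => (h'.reg r (hr.trans_le hb)).trans (h.reg r hr),
    fun k hk => (h'.arr k fun h => hk (hK h)).trans (h.arr k hk)⟩

/-- All numbers in the registers and in the arrays have absolute value at most `B`. -/
structure State.Fits (B : ℤ) (σ : State) : Prop where
  reg : ∀ r, |σ.reg r| ≤ B
  arr : ∀ k i, |σ.arr k i| ≤ B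

theorem State.Fits.setReg {B : ℤ} {σ : State} (h : σ.Fits B) (r : ℕ) {z : ℤ} (hz : |z| ≤ B) :
    (σ.setReg r z).Fits B := by
  refine ⟨fun r' => ?_, h.arr⟩
  rw [State.reg_setReg]
  split_ifs
  exacts [hz, h.reg r']

theorem State.Fits.setArr {B : ℤ} {σ : State} (h : σ.Fits B) (k i : ℕ) {z : ℤ} (hz : |z| ≤ B) :
    (σ.setArr k i z).Fits B := by
  refine ⟨h.reg, fun k' i' => ?_⟩
  rw [State.arr_setArr]
  split_ifs
  exacts [hz, h.arr k' i']

/-- The Hoare triple for `P` with memory bound `B`: if the numbers of the state `σ` are bounded by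
`B`, then so are those of the final state, which satisfies `Q`. The cost is at most `c` times
`2 * bits B ^ 2`, which bounds the cost of a single instruction on numbers bounded by `B`. -/
def Runs (B : ℤ) (c : ℕ) (P : Prog) (σ : State) (Q : State → Prop) : Prop :=
  σ.Fits B → (P.exec σ).1.Fits B ∧ Q (P.exec σ).1 ∧ (P.exec σ).2 ≤ c * (2 * bits B ^ 2)

variable {B : ℤ} {c c' : ℕ} {P P' : Prog} {σ : State} {Q Q' : State → Prop} {r s t k : ℕ}

theorem Runs.mono (h : Runs B c P σ Q) (hQ : ∀ τ, Q τ → Q' τ) : Runs B c P σ Q' :=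
  fun hσ => let ⟨hfit, hpost, hcost⟩ := h hσ
  ⟨hfit, hQ _ hpost, hcost⟩

theorem bits_add_bits_le {x y : ℤ} (hx : |x| ≤ B) (hy : |y| ≤ B) :
    bits x + bits y ≤ 1 * (2 * bits B ^ 2) := by
  have hbits := Nat.le_self_pow two_ne_zero (bits B)
  linarith [bits_le_bits hx, bits_le_bits hy]

theorem Runs.const {z : ℤ} (hz : |z| ≤ B) (hQ : Q (σ.setReg r z)) : Runs B 1 (.const r z) σ Q :=
  fun hσ => ⟨hσ.setReg r hz, hQ,
    (Nat.le_add_right _ _).trans (bits_add_bits_le hz hz)⟩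

theorem Runs.add (hB : |σ.reg s + σ.reg t| ≤ B) (hQ : Q (σ.setReg r (σ.reg s + σ.reg t))) :
    Runs B 1 (.add r s t) σ Q :=
  fun hσ => ⟨hσ.setReg r hB, hQ, bits_add_bits_le (hσ.reg s) (hσ.reg t)⟩

theorem Runs.sub (hB : |σ.reg s - σ.reg t| ≤ B) (hQ : Q (σ.setReg r (σ.reg s - σ.reg t))) :
    Runs B 1 (.sub r s t) σ Q :=
  fun hσ => ⟨hσ.setReg r hB, hQ, bits_add_bits_le (hσ.reg s) (hσ.reg t)⟩

theorem Runs.mul (hB : |σ.reg s * σ.reg t| ≤ B) (hQ : Q (σ.setReg r (σ.reg s * σ.reg t))) :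
    Runs B 1 (.mul r s t) σ Q :=
  fun hσ => ⟨hσ.setReg r hB, hQ, calc
    bits (σ.reg s) * bits (σ.reg t) ≤ bits B * bits B :=
      Nat.mul_le_mul (bits_le_bits (hσ.reg s)) (bits_le_bits (hσ.reg t))
    _ ≤ 1 * (2 * bits B ^ 2) := by nlinarith⟩

theorem Runs.load (hQ : Q (σ.setReg r (σ.arr k (σ.reg s).toNat))) :
    Runs B 1 (.load r k s) σ Q :=
  fun hσ => ⟨hσ.setReg r (hσ.arr _ _), hQ, bits_add_bits_le (hσ.reg s) (hσ.arr _ _)⟩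

theorem Runs.store (hQ : Q (σ.setArr k (σ.reg s).toNat (σ.reg r))) :
    Runs B 1 (.store k s r) σ Q :=
  fun hσ => ⟨hσ.setArr k _ (hσ.reg r), hQ, bits_add_bits_le (hσ.reg s) (hσ.reg r)⟩

theorem Runs.seq (h : Runs B c P σ fun τ => Runs B c' P' τ Q) :
    Runs B (c' + c) (.seq P P') σ Q := by
  intro hσ
  obtain ⟨hfit, hpost, hcost⟩ := h hσ
  obtain ⟨hfit', hpost', hcost'⟩ := hpost hfit
  refine ⟨hfit', hpost', (Nat.add_le_add hcost hcost').trans_eq ?_⟩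
  rw [add_mul, add_comm]

theorem Runs.loop {N : ℕ} (hN : σ.reg r = N) (I : ℕ → State → Prop) (h0 : I 0 σ)
    (hstep : ∀ i < N, ∀ τ, I i τ → Runs B c P τ (I (i + 1))) :
    Runs B (N * (c + 1) + 1) (.loop r P) σ (I N) := by
  intro hσ
  have hr : bits (σ.reg r) ≤ 2 * bits B ^ 2 := by
    linarith [bits_add_bits_le (hσ.reg r) (hσ.reg r)]
  rw [Prog.exec, hN, Int.toNat_natCast, ← hN]
  suffices H : ∀ i ≤ N, ∀ ν : State × ℕ, ν = (fun τ : State × ℕ =>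
      ((P.exec τ.1).1, τ.2 + (P.exec τ.1).2 + bits (σ.reg r)))^[i] (σ, bits (σ.reg r)) →
      ν.1.Fits B ∧ I i ν.1 ∧ ν.2 ≤ (i * (c + 1) + 1) * (2 * bits B ^ 2) from H N le_rfl _ rfl
  intro i
  induction i with
  | zero =>
    rintro - ν rfl
    exact ⟨hσ, h0, hr.trans_eq (by simp)⟩
  | succ i ih =>
    rintro hi ν rfl
    rw [Function.iterate_succ_apply']
    obtain ⟨hfit, hI, hcost⟩ := ih (by omega) _ rfl
    obtain ⟨hfit', hI', hcost'⟩ := hstep i hi _ hI hfit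
    refine ⟨hfit', hI', (Nat.add_le_add (Nat.add_le_add hcost hcost') hr).trans_eq ?_⟩
    ring

end Programs

/-! ### The program for the shift -/

section ShiftProgram

/-- One step of the program `dot`. -/
def dotStep (k k' s : ℕ) : Prog :=
  .seq (.load 10 k 8) <| .seq (.load 11 k' 9) <| .seq (.mul 10 10 11) <| .seq (.add 7 7 10) <|
    .seq (.add 8 8 s) <| .add 9 9 s

/-- Add to register `7` the sum of products `dotSum`, of as many terms as register `0` says, of the
arrays `k` and `k'`, from the positions in the registers `8` and `9` on, with the step that is held
in register `s`. -/
def dot (k k' s : ℕ) : Prog := .loop 0 (dotStep k k' s)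

/-- Run `P` for the values `0, 1, …` of register `5`, as many times as register `2` says, and write
the results, which `P` leaves in register `7`, to the array `k`. -/
def fill (k : ℕ) (P : Prog) : Prog :=
  .seq (.const 5 0) <| .loop 2 <| .seq P <| .seq (.store k 5 7) <| .add 5 5 1

/-- The computation of the entry of `t̄` whose index is in register `5`, by the formula
`tbarSum`. -/
def tbarEntry : Prog :=
  .seq (.const 7 0) <| .seq (.add 8 5 4) <| .seq (.add 9 5 3) <| dot 0 0 2

/-- The first sum of `shiftSum`, for the index in register `5`. -/
def shiftEntryFst : Prog :=
  .seq (.mul 6 5 2) <| .seq (.const 7 0) <| .seq (.add 8 6 4) <| .seq (.add 9 0 4) <| dot 0 2 1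

/-- The second sum of `shiftSum` minus the first one, given in register `7`. -/
def shiftEntrySnd : Prog :=
  .seq (.sub 7 4 7) <| .seq (.add 8 6 0) <| .seq (.const 9 0) <| dot 0 2 1

/-- The computation of the entry of `S Ω⁻¹ t̄` whose index is in register `5`, by the formula
`shiftSum`. -/
def shiftEntry : Prog := .seq shiftEntryFst shiftEntrySnd

/-- The computation of `S Ω⁻¹ t̄`. The registers `1`, `2`, `3`, `4` hold the constants `1`, `2n`,
`2n²`, `0`, and `t̄` is stored in array `2`. -/
def shiftProg : Prog :=
  .seq (.const 1 1) <| .seq (.add 2 0 0) <| .seq (.mul 3 0 2) <| .seq (.const 4 0) <|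
    .seq (fill 2 tbarEntry) <| fill 1 shiftEntry

/-- The sum of the products `a (p + m * d) * b (q + m * d)` for `m < n`. -/
def dotSum (a b : ℕ → ℤ) (p q d n : ℕ) : ℤ :=
  ∑ m ∈ Finset.range n, a (p + m * d) * b (q + m * d)

/-- The entry `j` of `t̄`, in terms of the array of the matrix. -/
def tbarSum (a : ℕ → ℤ) (n j : ℕ) : ℤ := dotSum a a j (j + n * (2 * n)) (2 * n) n

/-- The entry `i` of `S Ω⁻¹ t̄`, in terms of the arrays of the matrix `S` and of `t̄`. -/
def shiftSum (a t : ℕ → ℤ) (n i : ℕ) : ℤ :=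
  -dotSum a t (i * (2 * n)) n 1 n + dotSum a t (i * (2 * n) + n) 0 1 n

theorem dotSum_succ (a b : ℕ → ℤ) (p q d n : ℕ) :
    dotSum a b p q d (n + 1) = dotSum a b p q d n + a (p + n * d) * b (q + n * d) :=
  Finset.sum_range_succ _ _

theorem abs_dotSum_le {a b : ℕ → ℤ} {p q d n : ℕ} {X Y : ℤ} (ha : ∀ i, |a i| ≤ X)
    (hb : ∀ m < n, |b (q + m * d)| ≤ Y) : |dotSum a b p q d n| ≤ n * (X * Y) := by
  refine (Finset.abs_sum_le_sum_abs _ _).trans ?_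
  refine (Finset.sum_le_card_nsmul _ _ (X * Y) fun m hm => ?_).trans (by simp)
  rw [abs_mul]
  exact mul_le_mul (ha _) (hb m (Finset.mem_range.1 hm)) (abs_nonneg _)
    ((abs_nonneg _).trans (ha 0))

variable {B : ℤ} {σ : State}

theorem runs_dotStep {k k' s p q d : ℕ} (hs : s < 7) (hd : σ.reg s = d) (hp : σ.reg 8 = p)
    (hq : σ.reg 9 = q) (hmul : |σ.arr k p * σ.arr k' q| ≤ B)
    (hadd : |σ.reg 7 + σ.arr k p * σ.arr k' q| ≤ B) (hpd : (p + d : ℕ) ≤ B)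
    (hqd : (q + d : ℕ) ≤ B) :
    Runs B 6 (dotStep k k' s) σ fun τ => σ.EqOff 7 ∅ τ ∧
      τ.reg 7 = σ.reg 7 + σ.arr k p * σ.arr k' q ∧ τ.reg 8 = (p + d : ℕ) ∧
      τ.reg 9 = (q + d : ℕ) := by
  obtain ⟨h7, h8, h10, h11⟩ : s ≠ 7 ∧ s ≠ 8 ∧ s ≠ 10 ∧ s ≠ 11 := by omega
  have hpd' : |(p + d : ℤ)| ≤ B := by exact_mod_cast hpd
  have hqd' : |(q + d : ℤ)| ≤ B := by exact_mod_cast hqd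
  refine .seq (.load (.seq (.load (.seq (.mul ?_ (.seq (.add ?_ (.seq (.add ?_
    (.add ?_ ⟨?_, ?_, ?_, ?_⟩)))))))))) <;>
    simp [State.reg_setReg, State.arr_setReg, State.eqOff_setReg, State.EqOff.refl, -abs_mul, *]

theorem runs_dot {k k' s n p q d : ℕ} {X Y : ℤ} (hn : σ.reg 0 = n) (hs : s < 7)
    (hd : σ.reg s = d) (hp : σ.reg 8 = p) (hq : σ.reg 9 = q) (hX : ∀ i, |σ.arr k i| ≤ X)
    (hY : ∀ m < n, |σ.arr k' (q + m * d)| ≤ Y) (hB : |σ.reg 7| + n * (X * Y) ≤ B)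
    (hpd : (p + n * d : ℕ) ≤ B) (hqd : (q + n * d : ℕ) ≤ B) :
    Runs B (n * 7 + 1) (dot k k' s) σ fun τ => σ.EqOff 7 ∅ τ ∧
      τ.reg 7 = σ.reg 7 + dotSum (σ.arr k) (σ.arr k') p q d n := by
  refine (Runs.loop hn (fun m τ => σ.EqOff 7 ∅ τ ∧
    τ.reg 7 = σ.reg 7 + dotSum (σ.arr k) (σ.arr k') p q d m ∧
    τ.reg 8 = (p + m * d : ℕ) ∧ τ.reg 9 = (q + m * d : ℕ)) ⟨.refl _ _ _, ?_, ?_, ?_⟩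
    fun m hm τ ⟨heq, h7, h8, h9⟩ => ?_).mono fun τ h => ⟨h.1, h.2.1⟩
  · simp [dotSum]
  · simpa using hp
  · simpa using hq
  have hsucc := dotSum_succ (σ.arr k) (σ.arr k') p q d m
  have hY0 : 0 ≤ Y := (abs_nonneg _).trans (hY m hm)
  have hX0 : 0 ≤ X := (abs_nonneg _).trans (hX 0)
  have hmul : |σ.arr k (p + m * d) * σ.arr k' (q + m * d)| ≤ B := by
    rw [abs_mul]
    have hXY := mul_le_mul (hX (p + m * d)) (hY m hm) (abs_nonneg _) hX0
    have hn : X * Y ≤ n * (X * Y) := le_mul_of_one_le_left (mul_nonneg hX0 hY0) (by omega)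
    linarith [abs_nonneg (σ.reg 7)]
  have hsum : |σ.reg 7 + dotSum (σ.arr k) (σ.arr k') p q d (m + 1)| ≤ B := by
    have hdot := abs_dotSum_le (n := m + 1) (p := p) hX fun i hi => hY i (by omega)
    have hmn : ((m + 1 : ℕ) : ℤ) * (X * Y) ≤ n * (X * Y) := by gcongr; exact hm
    linarith [abs_add_le (σ.reg 7) (dotSum (σ.arr k) (σ.arr k') p q d (m + 1))]
  have hpos {x : ℕ} (hx : ((x + n * d : ℕ) : ℤ) ≤ B) : ((x + m * d + d : ℕ) : ℤ) ≤ B := by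
    refine le_trans (Int.ofNat_le.2 ?_) hx
    nlinarith
  rw [hsucc, ← add_assoc, ← h7] at hsum
  simp only [← heq.arr _ (Set.notMem_empty _)] at hmul hsum hsucc
  refine (runs_dotStep hs ((heq.reg s hs).trans hd) h8 h9 hmul hsum (hpos hpd) (hpos hqd)).mono
    fun υ ⟨heq', h7', h8', h9'⟩ => ⟨heq.trans heq' le_rfl le_rfl, ?_, ?_, ?_⟩
  · simp only [heq.arr _ (Set.notMem_empty _)] at hsucc h7'
    rw [h7', h7, hsucc, add_assoc]
  · rw [h8', add_assoc, add_one_mul]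
  · rw [h9', add_assoc, add_one_mul]

theorem runs_fill {k c N : ℕ} {P : Prog} {f : ℕ → ℤ} (hB : 1 ≤ B) (hNB : N ≤ B)
    (hone : σ.reg 1 = 1) (hN : σ.reg 2 = N)
    (hP : ∀ i < N, ∀ τ, σ.EqOff 5 {k} τ → τ.reg 5 = i →
      Runs B c P τ fun υ => τ.EqOff 6 ∅ υ ∧ υ.reg 7 = f i) :
    Runs B (N * (2 + c + 1) + 1 + 1) (fill k P) σ fun τ =>
      σ.EqOff 5 {k} τ ∧ ∀ i < N, τ.arr k i = f i := by
  refine .seq (.const (by simpa using zero_le_one.trans hB) ?_)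
  refine (Runs.loop (N := N) (by simpa [State.reg_setReg] using hN) (fun i τ => σ.EqOff 5 {k} τ ∧
    τ.reg 5 = i ∧ ∀ j < i, τ.arr k j = f j) ⟨?_, ?_, ?_⟩
    fun i hi τ ⟨heq, h5, harr⟩ => ?_).mono fun τ h => ⟨h.1, h.2.2⟩
  · simp [State.eqOff_setReg, State.EqOff.refl]
  · simp [State.reg_setReg]
  · simp
  refine .seq ((hP i hi τ heq h5).mono fun υ ⟨heq', h7⟩ => ?_)
  have h5' : υ.reg 5 = i := (heq'.reg 5 (by norm_num)).trans h5
  have hone' : υ.reg 1 = 1 :=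
    ((heq'.reg 1 (by norm_num)).trans (heq.reg 1 (by norm_num))).trans hone
  have hi' : |(i + 1 : ℤ)| ≤ B := by rw [abs_of_nonneg (by positivity)]; omega
  refine .seq (.store (.add ?_ ⟨?_, ?_, fun j hj => ?_⟩))
  · simpa [State.reg_setArr, h5', hone'] using hi'
  · simpa [State.eqOff_setReg, State.eqOff_setArr] using
      heq.trans heq' (by norm_num) (Set.empty_subset _)
  · simp [State.reg_setReg, State.reg_setArr, h5', hone']
  · rcases eq_or_ne j i with rfl | hji
    · simp [State.arr_setReg, State.arr_setArr, h5', h7]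
    · simp [State.arr_setReg, State.arr_setArr, h5', hji, heq'.arr, harr j (by omega)]

/-- The state of `shiftProg` after its preparations: the constants are in place, and array `0` has
entries of absolute value at most `X`. -/
structure State.IsPrepared (n : ℕ) (X : ℤ) (σ : State) : Prop where
  reg_zero : σ.reg 0 = n
  reg_one : σ.reg 1 = 1
  reg_two : σ.reg 2 = 2 * n
  reg_three : σ.reg 3 = n * (2 * n)
  reg_four : σ.reg 4 = 0
  abs_arr_zero_le : ∀ i, |σ.arr 0 i| ≤ X

variable {n i : ℕ} {X : ℤ}

theorem State.IsPrepared.of_eqOff {τ : State} {K : Set ℕ} (h : σ.IsPrepared n X)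
    (hτ : σ.EqOff 5 K τ) (hK : 0 ∉ K) : τ.IsPrepared n X where
  reg_zero := (hτ.reg 0 (by norm_num)).trans h.reg_zero
  reg_one := (hτ.reg 1 (by norm_num)).trans h.reg_one
  reg_two := (hτ.reg 2 (by norm_num)).trans h.reg_two
  reg_three := (hτ.reg 3 (by norm_num)).trans h.reg_three
  reg_four := (hτ.reg 4 (by norm_num)).trans h.reg_four
  abs_arr_zero_le := by simpa only [hτ.arr 0 hK] using h.abs_arr_zero_le

theorem runs_tbarEntry (hσ : σ.IsPrepared n X) (hi : i < 2 * n) (h5 : σ.reg 5 = i)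
    (hn : 2 * n * (2 * n + 1) ≤ B) (hB : n * (X * X) ≤ B) :
    Runs B (n * 7 + 4) tbarEntry σ fun τ =>
      σ.EqOff 6 ∅ τ ∧ τ.reg 7 = tbarSum (σ.arr 0) n i := by
  obtain ⟨h0, -, h2, h3, h4, hX⟩ := hσ
  have hB0 : 0 ≤ B := le_trans (by positivity) hn
  have hend : (i : ℤ) + n * (2 * n) + n * (2 * n) ≤ B := by
    refine le_trans ?_ hn
    norm_cast
    nlinarith
  have hq : (i + n * (2 * n) : ℤ) ≤ B := by nlinarith
  have hp : (i : ℤ) ≤ B := by nlinarith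
  have hq' : |(i + n * (2 * n) : ℤ)| ≤ B := by rwa [abs_of_nonneg (by positivity)]
  change Runs B (n * 7 + 1 + 1 + 1 + 1) _ _ _
  refine .seq (.const ?_ (.seq (.add ?_ (.seq (.add ?_
    ((runs_dot (n := n) (p := i) (q := i + n * (2 * n)) (d := 2 * n) (X := X) (Y := X)
      ?_ ?_ ?_ ?_ ?_ ?_ ?_ ?_ ?_ ?_).mono fun τ ⟨heq, h7⟩ => ⟨?_, ?_⟩))))))
  case refine_14 =>
    refine State.EqOff.trans ?_ heq (by norm_num) le_rfl
    simp [State.eqOff_setReg, State.EqOff.refl]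
  case refine_15 => simpa [State.reg_setReg, State.arr_setReg, tbarSum] using h7
  all_goals simp [State.reg_setReg, State.arr_setReg, *]

theorem runs_shiftEntryFst (hσ : σ.IsPrepared n X) (hi : i < 2 * n) (h5 : σ.reg 5 = i)
    (hn : 2 * n * (2 * n + 1) ≤ B) (ht : ∀ j < 2 * n, |σ.arr 2 j| ≤ n * (X * X))
    (hB : n * (X * (n * (X * X))) ≤ B) :
    Runs B (n * 7 + 5) shiftEntryFst σ fun τ => σ.EqOff 6 ∅ τ ∧ τ.reg 6 = i * (2 * n) ∧
      τ.reg 7 = dotSum (σ.arr 0) (σ.arr 2) (i * (2 * n)) n 1 n := by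
  obtain ⟨h0, h1, h2, -, h4, hX⟩ := hσ
  have hB0 : 0 ≤ B := le_trans (by positivity) hn
  have ht' (m : ℕ) (hm : m < n) : |σ.arr 2 (n + m)| ≤ n * (X * X) := ht _ (by omega)
  have hi' : (i : ℤ) + 1 ≤ 2 * n := by exact_mod_cast hi
  have hp : (i : ℤ) * (2 * n) ≤ B := by nlinarith [hi']
  have hp' : (i : ℤ) * (2 * n) + n ≤ B := by nlinarith [hi']
  have hq : (n : ℤ) ≤ B := by nlinarith
  have hq' : (n : ℤ) + n ≤ B := by nlinarith
  change Runs B (n * 7 + 1 + 1 + 1 + 1 + 1) _ _ _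
  refine .seq (.mul ?_ (.seq (.const ?_ (.seq (.add ?_ (.seq (.add ?_
    ((runs_dot (n := n) (p := i * (2 * n)) (q := n) (d := 1) (X := X) (Y := n * (X * X))
      ?_ ?_ ?_ ?_ ?_ ?_ ?_ ?_ ?_ ?_).mono fun τ ⟨heq, h7⟩ => ⟨?_, ?_, ?_⟩))))))))
  case refine_11 => simpa [State.arr_setReg] using ht'
  case refine_15 =>
    refine State.EqOff.trans ?_ heq (by norm_num) le_rfl
    simp [State.eqOff_setReg, State.EqOff.refl]
  case refine_16 =>
    refine (heq.reg 6 (by norm_num)).trans ?_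
    simp [State.reg_setReg, h5, h2]
  case refine_17 => simpa [State.reg_setReg, State.arr_setReg] using h7
  all_goals simp [State.reg_setReg, State.arr_setReg, *]

theorem runs_shiftEntrySnd (hσ : σ.IsPrepared n X) (hi : i < 2 * n) (h6 : σ.reg 6 = i * (2 * n))
    (hn : 2 * n * (2 * n + 1) ≤ B) (ht : ∀ j < 2 * n, |σ.arr 2 j| ≤ n * (X * X))
    (hB : |σ.reg 7| + n * (X * (n * (X * X))) ≤ B) :
    Runs B (n * 7 + 4) shiftEntrySnd σ fun τ => σ.EqOff 6 ∅ τ ∧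
      τ.reg 7 = -σ.reg 7 + dotSum (σ.arr 0) (σ.arr 2) (i * (2 * n) + n) 0 1 n := by
  obtain ⟨h0, h1, -, -, h4, hX⟩ := hσ
  have hB0 : 0 ≤ B := le_trans (by positivity) hn
  have ht' (m : ℕ) (hm : m < n) : |σ.arr 2 m| ≤ n * (X * X) := ht _ (by omega)
  have hX0 : 0 ≤ X := (abs_nonneg _).trans (hX 0)
  have h7B : |σ.reg 7| ≤ B := by nlinarith [show 0 ≤ n * (X * (n * (X * X))) by positivity]
  have hi' : (i : ℤ) + 1 ≤ 2 * n := by exact_mod_cast hi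
  have hp : |(i : ℤ) * (2 * n) + n| ≤ B := by rw [abs_of_nonneg (by positivity)]; nlinarith
  have hp' : (i : ℤ) * (2 * n) + n + n ≤ B := by nlinarith [hi']
  have hq : (n : ℤ) ≤ B := by nlinarith
  change Runs B (n * 7 + 1 + 1 + 1 + 1) _ _ _
  refine .seq (.sub ?_ (.seq (.add ?_ (.seq (.const ?_
    ((runs_dot (n := n) (p := i * (2 * n) + n) (q := 0) (d := 1) (X := X) (Y := n * (X * X))
      ?_ ?_ ?_ ?_ ?_ ?_ ?_ ?_ ?_ ?_).mono fun τ ⟨heq, h7⟩ => ⟨?_, ?_⟩))))))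
  case refine_10 => simpa [State.arr_setReg] using ht'
  case refine_14 =>
    refine State.EqOff.trans ?_ heq (by norm_num) le_rfl
    simp [State.eqOff_setReg, State.EqOff.refl]
  case refine_15 => simpa [State.reg_setReg, State.arr_setReg, h4] using h7
  all_goals simp [State.reg_setReg, State.arr_setReg, *]

theorem runs_shiftEntry (hσ : σ.IsPrepared n X) (hi : i < 2 * n) (h5 : σ.reg 5 = i)
    (hn : 2 * n * (2 * n + 1) ≤ B) (ht : ∀ j < 2 * n, |σ.arr 2 j| ≤ n * (X * X))
    (hB : 2 * (n * (X * (n * (X * X)))) ≤ B) :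
    Runs B (n * 7 + 4 + (n * 7 + 5)) shiftEntry σ fun τ =>
      σ.EqOff 6 ∅ τ ∧ τ.reg 7 = shiftSum (σ.arr 0) (σ.arr 2) n i := by
  have hX0 : 0 ≤ X := (abs_nonneg _).trans (hσ.abs_arr_zero_le 0)
  have hY0 : 0 ≤ n * (X * (n * (X * X))) := by positivity
  refine .seq ((runs_shiftEntryFst hσ hi h5 hn ht (by linarith)).mono fun τ ⟨heq, h6, h7⟩ => ?_)
  have harr (k : ℕ) : τ.arr k = σ.arr k := heq.arr k (Set.notMem_empty k)
  have hτ : τ.IsPrepared n X :=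
    hσ.of_eqOff ((State.EqOff.refl 5 ∅ σ).trans heq (by norm_num) le_rfl) (Set.notMem_empty 0)
  have h7B : |τ.reg 7| ≤ n * (X * (n * (X * X))) := by
    rw [h7]
    exact abs_dotSum_le hσ.abs_arr_zero_le fun m hm => ht _ (by omega)
  refine (runs_shiftEntrySnd hτ hi h6 hn (by simpa only [harr] using ht) (by linarith)).mono
    fun υ ⟨heq', h7'⟩ => ⟨heq.trans heq' le_rfl le_rfl, ?_⟩
  rw [h7', h7, harr, harr, shiftSum]

theorem dotSum_congr {a b b' : ℕ → ℤ} {p q d n : ℕ}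
    (h : ∀ m < n, b (q + m * d) = b' (q + m * d)) : dotSum a b p q d n = dotSum a b' p q d n :=
  Finset.sum_congr rfl fun m hm => by rw [h m (Finset.mem_range.1 hm)]

theorem shiftSum_congr {a t t' : ℕ → ℤ} (h : ∀ j < 2 * n, t j = t' j) :
    shiftSum a t n i = shiftSum a t' n i := by
  rw [shiftSum, shiftSum, dotSum_congr fun m hm => h (n + m * 1) (by omega),
    dotSum_congr fun m hm => h (0 + m * 1) (by omega)]

theorem runs_fill_tbarEntry_fill_shiftEntry (hσ : σ.IsPrepared n X) (hB : 1 ≤ B)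
    (hn : 2 * n * (2 * n + 1) ≤ B) (hB₁ : n * (X * X) ≤ B)
    (hB₂ : 2 * (n * (X * (n * (X * X)))) ≤ B) :
    Runs B (42 * n ^ 2 + 38 * n + 4) (.seq (fill 2 tbarEntry) (fill 1 shiftEntry)) σ fun τ =>
      ∀ i < 2 * n, τ.arr 1 i = shiftSum (σ.arr 0) (tbarSum (σ.arr 0) n) n i := by
  have hN : (2 * n : ℕ) ≤ B := by
    push_cast
    nlinarith
  have hcost : 42 * n ^ 2 + 38 * n + 4 = 2 * n * (2 + (n * 7 + 4 + (n * 7 + 5)) + 1) + 1 + 1 +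
      (2 * n * (2 + (n * 7 + 4) + 1) + 1 + 1) := by ring
  rw [hcost]
  refine .seq ((runs_fill (f := tbarSum (σ.arr 0) n) hB hN hσ.reg_one
    (by simpa using hσ.reg_two) fun j hj τ heq h5 => ?_).mono fun τ ⟨heq, htbar⟩ => ?_)
  · rw [← heq.arr 0 (by simp)]
    exact runs_tbarEntry (hσ.of_eqOff heq (by simp)) hj h5 hn hB₁
  have hτ : τ.IsPrepared n X := hσ.of_eqOff heq (by simp)
  refine (runs_fill hB hN hτ.reg_one (by simpa using hτ.reg_two)
    fun i hi υ heq' h5 => ?_).mono fun υ h => h.2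
  have h2 (j : ℕ) (hj : j < 2 * n) : υ.arr 2 j = tbarSum (σ.arr 0) n j := by
    rw [heq'.arr 2 (by simp), htbar j hj]
  rw [← shiftSum_congr h2, ← heq.arr 0 (by simp), ← heq'.arr 0 (by simp)]
  refine runs_shiftEntry (hτ.of_eqOff heq' (by simp)) hi h5 hn (fun j hj => ?_) hB₂
  rw [h2 j hj]
  exact abs_dotSum_le hσ.abs_arr_zero_le fun m _ => hσ.abs_arr_zero_le _

theorem runs_shiftProg (h0 : σ.reg 0 = n) (harr : ∀ i, |σ.arr 0 i| ≤ X) (hX : 1 ≤ X)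
    (hn : 2 * n * (2 * n + 1) ≤ X) :
    Runs (X ^ 4) (42 * n ^ 2 + 38 * n + 8) shiftProg σ fun τ =>
      ∀ i < 2 * n, τ.arr 1 i = shiftSum (σ.arr 0) (tbarSum (σ.arr 0) n) n i := by
  have hXB : X ≤ X ^ 4 := le_self_pow₀ hX four_ne_zero
  have hnX : (n : ℤ) ≤ X := by nlinarith
  have hB₁ : n * (X * X) ≤ X ^ 4 := calc
    n * (X * X) ≤ X * (X * X) * 1 := by rw [mul_one]; gcongr
    _ ≤ X * (X * X) * X := by gcongr
    _ = X ^ 4 := by ring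
  have hB₂ : 2 * (n * (X * (n * (X * X)))) ≤ X ^ 4 := calc
    2 * (n * (X * (n * (X * X)))) = 2 * n * n * X ^ 3 := by ring
    _ ≤ X * X ^ 3 := by gcongr; nlinarith
    _ = X ^ 4 := by ring
  have h2n : |(n + n : ℤ)| ≤ X ^ 4 := by rw [abs_of_nonneg (by positivity)]; nlinarith
  have h2n2 : |(n * (n + n) : ℤ)| ≤ X ^ 4 := by rw [abs_of_nonneg (by positivity)]; nlinarith
  change Runs (X ^ 4) (42 * n ^ 2 + 38 * n + 4 + 1 + 1 + 1 + 1) _ _ _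
  refine .seq (.const (by simpa using hX.trans hXB) (.seq (.add ?_ (.seq (.mul ?_
    (.seq (.const (by simpa using zero_le_one.trans (hX.trans hXB))
    (runs_fill_tbarEntry_fill_shiftEntry ⟨?_, ?_, ?_, ?_, ?_, harr⟩ (hX.trans hXB)
      (hn.trans hXB) hB₁ hB₂))))))))
  all_goals simp [State.reg_setReg, h0, two_mul, h2n, h2n2, -abs_mul]

end ShiftProgram

section MatrixArray

variable {n : ℕ} (S : Matrix (Fin n ⊕ Fin n) (Fin n ⊕ Fin n) ℤ)

theorem position_inl (j : Fin n) : position (Sum.inl j : Fin n ⊕ Fin n) = j := by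
  simp [position]

theorem position_inr (j : Fin n) : position (Sum.inr j : Fin n ⊕ Fin n) = n + j := by
  simp [position, add_comm]

theorem position_lt (i : Fin n ⊕ Fin n) : position i < 2 * n :=
  (finSumFinEquiv i).isLt.trans_eq (two_mul n).symm

theorem matrixArray_position (i j : Fin n ⊕ Fin n) :
    matrixArray S (position i * (2 * n) + position j) = S i j := by
  have h : position i * (2 * n) + position j =
      (finProdFinEquiv (finSumFinEquiv i, finSumFinEquiv j) : Fin ((n + n) * (n + n))) := by
    simp only [finProdFinEquiv_apply_val, position]
    ring
  rw [h, matrixArray, dif_pos (Fin.isLt _), Fin.eta, Equiv.symm_apply_apply]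
  simp

theorem tbarSum_matrixArray (j : Fin n ⊕ Fin n) :
    tbarSum (matrixArray S) n (position j) = tbar S j := by
  have hX (m : Fin n) : matrixArray S (position j + m * (2 * n)) = S (Sum.inl m) j := by
    rw [← matrixArray_position S, position_inl, add_comm]
  have hZ (m : Fin n) :
      matrixArray S (position j + n * (2 * n) + m * (2 * n)) = S (Sum.inr m) j := by
    rw [← matrixArray_position S, position_inr, add_mul, add_assoc, add_comm]
  rw [tbarSum, dotSum, Finset.sum_range]
  simp only [hX, hZ]
  cases j <;> simp [tbar, Matrix.mul_apply, Matrix.toBlocks₁₁, Matrix.toBlocks₁₂,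
    Matrix.toBlocks₂₁, Matrix.toBlocks₂₂]

theorem shiftCoeff_apply (i : Fin n ⊕ Fin n) : shiftCoeff S i =
    -∑ m, S i (Sum.inl m) * tbar S (Sum.inr m) + ∑ m, S i (Sum.inr m) * tbar S (Sum.inl m) := by
  rw [shiftCoeff, Omega_inv, Matrix.mulVec, Matrix.mul_neg, dotProduct, Fintype.sum_sum_type]
  simp [Omega, Matrix.mul_apply, Matrix.one_apply, Matrix.fromBlocks]
  ring

theorem shiftSum_matrixArray (i : Fin n ⊕ Fin n) :
    shiftSum (matrixArray S) (tbarSum (matrixArray S) n) n (position i) = shiftCoeff S i := by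
  rw [shiftCoeff_apply, shiftSum, dotSum, dotSum, Finset.sum_range, Finset.sum_range]
  simp only [mul_one, zero_add, add_assoc, ← position_inr]
  simp only [← position_inl, matrixArray_position, tbarSum_matrixArray]

theorem bits_le_bitLength (i j : Fin n ⊕ Fin n) : bits (S i j) ≤ bitLength S :=
  (Finset.single_le_sum (f := fun j => bits (S i j)) (fun _ _ => Nat.zero_le _)
    (Finset.mem_univ j)).trans
    (Finset.single_le_sum (f := fun i => ∑ j, bits (S i j)) (fun _ _ => Nat.zero_le _)
      (Finset.mem_univ i))

theorem card_le_bitLength : 2 * n * (2 * n) ≤ bitLength S := by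
  have h : ∑ _i : Fin n ⊕ Fin n, ∑ _j : Fin n ⊕ Fin n, 1 ≤ bitLength S :=
    Finset.sum_le_sum fun i _ => Finset.sum_le_sum fun j _ => Nat.succ_le_succ (Nat.zero_le _)
  simpa [← two_mul] using h

theorem abs_matrixArray_le (p : ℕ) : |matrixArray S p| ≤ 2 ^ bitLength S := by
  rw [matrixArray]
  split_ifs
  · exact (abs_lt_two_pow_bits _).le.trans
      (pow_le_pow_right₀ one_le_two (bits_le_bitLength S _ _))
  · rw [abs_zero]
    positivity

theorem fits_inputState {B : ℤ} (hB : 0 ≤ B) (hn : n ≤ B) (hS : ∀ p, |matrixArray S p| ≤ B) :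
    (inputState S).Fits B where
  reg r := by
    simp only [inputState]
    split_ifs <;> simpa
  arr k p := by
    simp only [inputState]
    split_ifs
    exacts [hS p, by simpa]

end MatrixArray

theorem polyTimeOn_shiftCoeff
    (p : ∀ n : ℕ, Matrix (Fin n ⊕ Fin n) (Fin n ⊕ Fin n) ℤ → Prop) :
    PolyTimeOn p fun _ S => shiftCoeff S := by
  refine ⟨shiftProg, 2016, 3, fun n S _ => ?_⟩
  obtain ⟨L, hL⟩ : ∃ L, L = bitLength S + 1 := ⟨_, rfl⟩
  have hcard : 4 * n ^ 2 + 1 ≤ L := by nlinarith [card_le_bitLength S]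
  have hX : (1 : ℤ) ≤ 2 ^ L := one_le_pow₀ one_le_two
  have hXB : (2 : ℤ) ^ L ≤ (2 ^ L) ^ 4 := le_self_pow₀ hX four_ne_zero
  have hn : 2 * n * (2 * n + 1) ≤ (2 : ℤ) ^ L := by
    have hL2 : 2 * bitLength S < 2 ^ L := by
      rw [hL, pow_succ']
      exact Nat.mul_lt_mul_of_pos_left Nat.lt_two_pow_self two_pos
    have h : 2 * n * (2 * n + 1) ≤ 2 ^ L := by
      nlinarith [card_le_bitLength S, Nat.le_self_pow two_ne_zero n]
    exact_mod_cast h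
  have hS (q : ℕ) : |matrixArray S q| ≤ 2 ^ L :=
    (abs_matrixArray_le S q).trans (pow_le_pow_right₀ one_le_two (by omega))
  obtain ⟨-, harr, hcost⟩ := runs_shiftProg (σ := inputState S) rfl hS hX hn
    (fits_inputState S (by positivity) (by nlinarith) fun q => (hS q).trans hXB)
  refine ⟨fun i => (harr _ (position_lt i)).trans (shiftSum_matrixArray S i), ?_⟩
  have hbits : bits ((2 ^ L) ^ 4) ≤ 6 * L := by
    refine (bits_le_of_abs_le_two_pow (m := L * 4) ?_).trans (by omega)
    rw [← pow_mul, abs_of_nonneg (by positivity)]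
  rw [← hL]
  calc (Prog.exec shiftProg (inputState S)).2
      ≤ (42 * n ^ 2 + 38 * n + 8) * (2 * bits ((2 ^ L) ^ 4) ^ 2) := hcost
    _ ≤ (28 * L) * (2 * (6 * L) ^ 2) := by
      gcongr
      nlinarith [Nat.le_self_pow two_ne_zero n]
    _ = 2016 * L ^ 3 := by ring

end ZakGross

theorem theorem1_general :
    (∀ (n d : ℕ), 0 < d →
      ∀ S : Matrix (Fin n ⊕ Fin n) (Fin n ⊕ Fin n) ℤ, S ∈ Matrix.symplecticGroup (Fin n) ℤ →
      ∀ U : ZakGross.Modes n →L[ℂ] ZakGross.Modes n,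
        ZakGross.IsGaussianUnitary (ZakGross.realMat S) U →
      ∀ ρ : ZakGross.Modes n →L[ℂ] ZakGross.Modes n, ZakGross.IsTraceClass ρ →
        (∀ η : Fin n ⊕ Fin n → ℝ,
          (Summable (ZakGross.wignerTerm d (U * ρ * star U) η) ↔
            Summable (ZakGross.wignerTerm d ρ (ZakGross.realMat S *ᵥ η - ZakGross.shift d S))) ∧
          ZakGross.zakGrossWigner d (U * ρ * star U) η =
            ZakGross.zakGrossWigner d ρ (ZakGross.realMat S *ᵥ η - ZakGross.shift d S)) ∧
        (∀ φ : 𝓢(Fin n ⊕ Fin n → ℝ, ℂ),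
          Summable (ZakGross.smearedTerm d (U * ρ * star U) φ) ∧
          Summable (ZakGross.smearedTerm d ρ
            (fun ξ => φ ((ZakGross.realMat S)⁻¹ *ᵥ (ξ + ZakGross.shift d S)))) ∧
          ZakGross.smearedWigner d (U * ρ * star U) φ =
            ZakGross.smearedWigner d ρ
              (fun ξ => φ ((ZakGross.realMat S)⁻¹ *ᵥ (ξ + ZakGross.shift d S))))) ∧
    ∀ p, ZakGross.PolyTimeOn p (fun _ S => ZakGross.shiftCoeff S) :=
  ⟨fun _ _ hd _ hS _ hU _ hρ =>
    ⟨fun η => ZakGross.zakGrossWigner_conj hd hS hU hρ η,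
      fun φ => ZakGross.smearedWigner_conj hd hS hU hρ φ⟩,
    ZakGross.polyTimeOn_shiftCoeff⟩

theorem theorem1 :
    (∀ (n d : ℕ), Odd d →
      ∀ S : Matrix (Fin n ⊕ Fin n) (Fin n ⊕ Fin n) ℤ, S ∈ Matrix.symplecticGroup (Fin n) ℤ →
      ∀ U : ZakGross.Modes n →L[ℂ] ZakGross.Modes n,
        ZakGross.IsGaussianUnitary (ZakGross.realMat S) U →
      ∀ ρ : ZakGross.Modes n →L[ℂ] ZakGross.Modes n, ZakGross.IsDensityOperator ρ →
        -- the identity at every point `η` (both series converge, or neither does)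
        (∀ η : Fin n ⊕ Fin n → ℝ,
          (Summable (ZakGross.wignerTerm d (U * ρ * star U) η) ↔
            Summable (ZakGross.wignerTerm d ρ (ZakGross.realMat S *ᵥ η - ZakGross.shift d S))) ∧
          ZakGross.zakGrossWigner d (U * ρ * star U) η =
            ZakGross.zakGrossWigner d ρ (ZakGross.realMat S *ᵥ η - ZakGross.shift d S)) ∧
        -- the identity of distributions (both series always converge)
        (∀ φ : 𝓢(Fin n ⊕ Fin n → ℝ, ℂ),
          Summable (ZakGross.smearedTerm d (U * ρ * star U) φ) ∧
          Summable (ZakGross.smearedTerm d ρ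
            (fun ξ => φ ((ZakGross.realMat S)⁻¹ *ᵥ (ξ + ZakGross.shift d S)))) ∧
          ZakGross.smearedWigner d (U * ρ * star U) φ =
            ZakGross.smearedWigner d ρ
              (fun ξ => φ ((ZakGross.realMat S)⁻¹ *ᵥ (ξ + ZakGross.shift d S))))) ∧
    -- the integer vector `S Ω⁻¹ t̄`, which gives the shift in units of `π/ℓ`, is computable in
    -- polynomial time from `S`
    ZakGross.PolyTimeOn (fun n S => S ∈ Matrix.symplecticGroup (Fin n) ℤ)
      (fun _ S => ZakGross.shiftCoeff S) :=
  ⟨fun n d hd S hS U hU ρ hρ =>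
    theorem1_general.1 n d hd.pos S hS U hU ρ hρ.isTraceClass, theorem1_general.2 _⟩
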